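/- Let $\epsilon\in(0,1/2)$, $p\in[\epsilon,1-\epsilon]$, $\alpha\in(0,1)$ and $\delta>0$. There are infinitely many coins, indexed by $i\in\mathbb N$. Independently of the others, each coin is heavy with probability $\alpha$ and not-heavy with probability $1-\alpha$; given the types, all tosses are independent, and a toss shows heads with probability $p+\epsilon$ for a heavy coin and $p-\epsilon$ for a not-heavy coin. A history is a finite sequence of (coin, outcome) pairs. An adaptive strategy chooses from the current history either a coin to toss next, or a coin to output, in which case it stops. It is called admissible (it identifies a heavy coin with correctness at least $1-\delta$) if, at every history at which it stops, the coin that it outputs is heavy with conditional probability at least $1-\delta$ given that history. The cost of a strategy at a history is the conditional expectation, given that history, of the number of further tosses that it makes. If a coin $i$ has shown $h_i$ heads and $t_i$ tails, its likelihood ratio is $L_i=\left(\frac{p+\epsilon}{p-\epsilon}\right)^{h_i}\left(\frac{1-p-\epsilon}{1-p+\epsilon}\right)^{t_i}\in[0,\infty]$. A strategy follows Likelihood-Toss if, as long as $L_i<\frac{(1-\alpha)(1-\delta)}{\alpha\delta}$ for all $i$, it tosses a coin with the largest likelihood ratio, and otherwise stops and outputs a coin with the largest likelihood ratio; ties are broken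 arbitrarily. (1) Every strategy that follows Likelihood-Toss is an optimal adaptive strategy: it is admissible, and at every history its cost is finite and at most the cost of every admissible strategy, including randomized mixtures of admissible strategies. Moreover, at every history, the conditional probability that it eventually stops and outputs a heavy coin is at least $1-\delta$. (2) There are an online algorithm $A$, namely one program for a random access machine with unit-cost instructions on natural numbers (constants, addition, truncated subtraction, halving, comparison) and on real numbers (constants, arithmetic, comparison) and with directly addressable arrays, and a constant $C$, such that for all $p,\epsilon,\alpha,\delta$ as above, given as input, $A$ computes a strategy that follows Likelihood-Toss: after the tosses of any history have been reported to it one by one, it answers with the next move, and the time from the report of the last toss (from the start, if there is none) to the answer is at most $C\log(n_0+2)$, where $n_0$ is the number of different coins that have been tossed so far. -/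

import Mathlib

open MeasureTheory ProbabilityTheory
open scoped ENNReal

noncomputable section

namespace CoinLearning

/-! ### The coins -/

/-- The parameters: a heavy coin shows heads with probability `p + ε`, a not-heavy coin with
probability `p - ε`, each coin is heavy with probability `α`, and `δ` is the tolerated error. -/
structure Setting where
  p : ℝ
  ε : ℝ
  α : ℝ
  δ : ℝ
  ε_pos : 0 < ε
  ε_lt : ε < 1 / 2
  ε_le_p : ε ≤ p
  p_le : p ≤ 1 - ε
  α_pos : 0 < α
  α_lt : α < 1
  δ_pos : 0 < δ

/-- A sample point. For every coin `i : ℕ`, `(ω i).1` says whether coin `i` is heavy and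
`(ω i).2 k` is the outcome of its toss number `k` (counted from `0`; `true` is heads). -/
abbrev World : Type := ℕ → Bool × (ℕ → Bool)

namespace Setting

variable (θ : Setting)

/-- The probability of heads of a heavy coin (`true`) and of a not-heavy coin (`false`). -/
def bias : Bool → unitInterval
  | true => ⟨θ.p + θ.ε, by linarith [θ.ε_pos, θ.ε_le_p], by linarith [θ.p_le]⟩
  | false => ⟨θ.p - θ.ε, by linarith [θ.ε_le_p], by linarith [θ.ε_pos, θ.p_le]⟩

/-- The law of the infinite sequence of outcomes of a coin whose type is given: independent tosses
with the bias of that type. -/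
def outcomesLaw (heavy : Bool) : Measure (ℕ → Bool) :=
  Measure.infinitePi fun _ : ℕ => bernoulliMeasure true false (θ.bias heavy)

instance (heavy : Bool) : IsProbabilityMeasure (θ.outcomesLaw heavy) := by
  unfold outcomesLaw; infer_instance

/-- The law of one coin: its type is drawn first, then the outcomes of its tosses. -/
def coinLaw : Measure (Bool × (ℕ → Bool)) :=
  ENNReal.ofReal θ.α • (Measure.dirac true).prod (θ.outcomesLaw true) +
    ENNReal.ofReal (1 - θ.α) • (Measure.dirac false).prod (θ.outcomesLaw false)

instance : IsProbabilityMeasure θ.coinLaw := by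
  constructor
  have h : (0 : ℝ) ≤ 1 - θ.α := by linarith [θ.α_lt]
  simp only [coinLaw, Measure.coe_add, Measure.coe_smul, Pi.add_apply, Pi.smul_apply, measure_univ,
    smul_eq_mul, mul_one]
  rw [← ENNReal.ofReal_add θ.α_pos.le h]
  simp

/-- The law of the whole infinite collection: the coins are independent and identically
distributed. -/
def law : Measure World := Measure.infinitePi fun _ : ℕ => θ.coinLaw

instance : IsProbabilityMeasure θ.law := by
  unfold law; infer_instance

end Setting

/-! ### Histories and strategies -/

/-- A history of outcomes: the list of the tosses made so far (coin, outcome), latest toss first. -/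
abbrev History : Type := List (ℕ × Bool)

namespace History

/-- The number of heads of coin `i`. -/
def heads (h : History) (i : ℕ) : ℕ := h.count (i, true)

/-- The number of tails of coin `i`. -/
def tails (h : History) (i : ℕ) : ℕ := h.count (i, false)

/-- The number of tosses of coin `i`. -/
def tosses (h : History) (i : ℕ) : ℕ := heads h i + tails h i

/-- The number of distinct coins that have been tossed. -/
def numCoins (h : History) : ℕ := (h.map Prod.fst).toFinset.card

/-- The event that the tosses listed in the history have the outcomes listed there. -/
def event : History → Set World
  | [] => Set.univ
  | (i, b) :: h => {ω | (ω i).2 (tosses h i) = b} ∩ event h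

end History

/-- What can be done next: toss a coin, or stop and output a coin. -/
inductive Move : Type
  | toss (i : ℕ)
  | output (i : ℕ)

/-- A (pure) adaptive strategy chooses the next action from the history. -/
abbrev Strategy : Type := History → Move

namespace Strategy

/-- One step: perform the chosen action. Nothing happens any more once a coin is output. -/
def step (σ : Strategy) (ω : World) (h : History) : History :=
  match σ h with
  | .toss i => (i, (ω i).2 (History.tosses h i)) :: h
  | .output _ => h

/-- The history after `n` steps, for a strategy that takes over at the history `h`. -/
def run (σ : Strategy) (ω : World) (h : History) (n : ℕ) : History :=
  (step σ ω)^[n] h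

/-- `1` if the strategy tosses a coin at this history, and `0` if it stops. -/
def tossIndicator (σ : Strategy) (h : History) : ℝ≥0∞ :=
  match σ h with
  | .toss _ => 1
  | .output _ => 0

/-- The number of further tosses (possibly infinite) after the history `h`. -/
def furtherTosses (σ : Strategy) (h : History) (ω : World) : ℝ≥0∞ :=
  ∑' n : ℕ, tossIndicator σ (run σ ω h n)

end Strategy

namespace Setting

variable (θ : Setting)

/-- The probability measure on sample points given the history. -/
def given (h : History) : Measure World := cond θ.law (History.event h)

/-- The conditional probability that coin `i` is heavy, given the history. -/
def posterior (h : History) (i : ℕ) : ℝ := (θ.given h).real {ω | (ω i).1 = true}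

/-- The cost of a strategy at a history: the conditional expectation, given that history, of the
number of further tosses made by the strategy. -/
def cost (σ : Strategy) (h : History) : ℝ≥0∞ :=
  ∫⁻ ω, Strategy.furtherTosses σ h ω ∂(θ.given h)

/-- A strategy identifies a heavy coin with correctness at least `1 - δ` if, given the history at
which it stops, the coin that it outputs is heavy with probability at least `1 - δ`. -/
def Admissible (σ : Strategy) : Prop :=
  ∀ (h : History) (i : ℕ), σ h = .output i → 1 - θ.δ ≤ θ.posterior h i

/-- An optimal adaptive strategy: it is admissible, and at every history its cost is finite and
least among the costs of all strategies that are admissible. The competing strategies may be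
randomized: a mixed strategy follows the pure strategy `τ s`, where `s` is a random seed with law
`ν`, and its cost is the average of the costs of the `τ s`. -/
def IsOptimal (σ : Strategy) : Prop :=
  θ.Admissible σ ∧
  ∀ h : History, θ.cost σ h < ∞ ∧
    ∀ (S : Type) [MeasurableSpace S] (ν : Measure S) [IsProbabilityMeasure ν] (τ : S → Strategy),
      (∀ s, θ.Admissible (τ s)) → θ.cost σ h ≤ ∫⁻ s, θ.cost (τ s) h ∂ν

/-- The conditional probability, given the history `h`, that the strategy, when it takes over at
`h`, stops and outputs a coin that is heavy. -/
def successProb (σ : Strategy) (h : History) : ℝ :=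
  (θ.given h).real
    {ω | ∃ n i, σ (Strategy.run σ ω h n) = .output i ∧ (ω i).1 = true}

/-! ### Likelihood-Toss -/

/-- The likelihood ratio of coin `i`. It lies in `[0, ∞]`: it is `∞` after a head if `p = ε`. -/
def likelihoodRatio (h : History) (i : ℕ) : ℝ≥0∞ :=
  (ENNReal.ofReal (θ.p + θ.ε) / ENNReal.ofReal (θ.p - θ.ε)) ^ History.heads h i *
    (ENNReal.ofReal (1 - θ.p - θ.ε) / ENNReal.ofReal (1 - θ.p + θ.ε)) ^ History.tails h i

/-- The stopping threshold for the likelihood ratios (a negative one is the same as `0`). -/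
def threshold : ℝ≥0∞ := ENNReal.ofReal ((1 - θ.α) * (1 - θ.δ) / (θ.α * θ.δ))

/-- Coin `i` has the largest likelihood ratio. -/
def IsArgmax (h : History) (i : ℕ) : Prop :=
  ∀ j, θ.likelihoodRatio h j ≤ θ.likelihoodRatio h i

/-- The strategy follows Likelihood-Toss, with some way of breaking ties: as long as all likelihood
ratios are below the threshold, it tosses a coin with the largest one; otherwise it stops and
outputs a coin with the largest one. -/
def IsLikelihoodToss (σ : Strategy) : Prop :=
  ∀ h : History,
    ((∀ i, θ.likelihoodRatio h i < θ.threshold) → ∃ i, θ.IsArgmax h i ∧ σ h = .toss i) ∧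
    ((∃ i, θ.threshold ≤ θ.likelihoodRatio h i) → ∃ i, θ.IsArgmax h i ∧ σ h = .output i)

end Setting

/-! ### Running time: a random access machine with unit cost per instruction -/

/-- A memory state: registers and arrays of natural numbers, registers and arrays of real numbers.
An array is named by the program; its cells are addressed by natural numbers. -/
structure Store where
  nreg : ℕ → ℕ
  rreg : ℕ → ℝ
  nmem : ℕ → ℕ → ℕ
  rmem : ℕ → ℕ → ℝ

/-- Elementary instructions; `d` is the target register. -/
inductive Instr : Type
  | nconst (d k : ℕ)
  | nadd (d a b : ℕ)
  | nsub (d a b : ℕ)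
  | nhalf (d a : ℕ)
  | nload (d arr a : ℕ)
  | nstore (arr a b : ℕ)
  | rconst (d k : ℕ)
  | radd (d a b : ℕ)
  | rsub (d a b : ℕ)
  | rmul (d a b : ℕ)
  | rdiv (d a b : ℕ)
  | rload (d arr a : ℕ)
  | rstore (arr a b : ℕ)

namespace Store

/-- Write a register of natural numbers. -/
def setN (s : Store) (d v : ℕ) : Store := { s with nreg := Function.update s.nreg d v }

/-- Write a register of real numbers. -/
def setR (s : Store) (d : ℕ) (v : ℝ) : Store := { s with rreg := Function.update s.rreg d v }

/-- The effect of an elementary instruction: constants, truncated subtraction and halving (rounded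
down) of natural numbers, the field operations on real numbers (with `x / 0 = 0`), and reading and
writing the cell of an array whose address is in register `a`. -/
def exec (s : Store) : Instr → Store
  | .nconst d k => s.setN d k
  | .nadd d a b => s.setN d (s.nreg a + s.nreg b)
  | .nsub d a b => s.setN d (s.nreg a - s.nreg b)
  | .nhalf d a => s.setN d (s.nreg a / 2)
  | .nload d arr a => s.setN d (s.nmem arr (s.nreg a))
  | .nstore arr a b =>
      { s with nmem := Function.update s.nmem arr
                 (Function.update (s.nmem arr) (s.nreg a) (s.nreg b)) }
  | .rconst d k => s.setR d k
  | .radd d a b => s.setR d (s.rreg a + s.rreg b)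
  | .rsub d a b => s.setR d (s.rreg a - s.rreg b)
  | .rmul d a b => s.setR d (s.rreg a * s.rreg b)
  | .rdiv d a b => s.setR d (s.rreg a / s.rreg b)
  | .rload d arr a => s.setR d (s.rmem arr (s.nreg a))
  | .rstore arr a b =>
      { s with rmem := Function.update s.rmem arr
                 (Function.update (s.rmem arr) (s.nreg a) (s.rreg b)) }

end Store

/-- Tests: comparison of two registers. -/
inductive Test : Type
  | nle (a b : ℕ)
  | rle (a b : ℕ)

/-- The truth value of a test. -/
def Test.Holds (s : Store) : Test → Prop
  | .nle a b => s.nreg a ≤ s.nreg b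
  | .rle a b => s.rreg a ≤ s.rreg b

/-- Programs. -/
inductive Cmd : Type
  | skip
  | instr (c : Instr)
  | seq (c₁ c₂ : Cmd)
  | ite (b : Test) (c₁ c₂ : Cmd)
  | loop (b : Test) (c : Cmd)

/-- `Exec c s t s'`: started in the state `s`, the program `c` halts in the state `s'` after `t`
units of time; every elementary instruction and every evaluation of a test takes one unit. -/
inductive Exec : Cmd → Store → ℕ → Store → Prop
  | skip (s : Store) : Exec .skip s 0 s
  | instr (c : Instr) (s : Store) : Exec (.instr c) s 1 (s.exec c)
  | seq {c₁ c₂ : Cmd} {s s' s'' : Store} {t t' : ℕ} :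
      Exec c₁ s t s' → Exec c₂ s' t' s'' → Exec (.seq c₁ c₂) s (t + t') s''
  | ite_true {b : Test} {c₁ c₂ : Cmd} {s s' : Store} {t : ℕ} :
      b.Holds s → Exec c₁ s t s' → Exec (.ite b c₁ c₂) s (t + 1) s'
  | ite_false {b : Test} {c₁ c₂ : Cmd} {s s' : Store} {t : ℕ} :
      ¬ b.Holds s → Exec c₂ s t s' → Exec (.ite b c₁ c₂) s (t + 1) s'
  | loop_done {b : Test} {c : Cmd} {s : Store} :
      ¬ b.Holds s → Exec (.loop b c) s 1 s
  | loop_next {b : Test} {c : Cmd} {s s' s'' : Store} {t t' : ℕ} :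
      b.Holds s → Exec c s t s' → Exec (.loop b c) s' t' s'' →
      Exec (.loop b c) s (t + t' + 1) s''

/-- An online algorithm: `start` is run once, before the first toss, and `next` is run after every
toss. Each time the program halts, its answer says what to do next. -/
structure OnlineAlgorithm where
  start : Cmd
  next : Cmd

namespace Store

/-- The initial state: `p`, `ε`, `α`, `δ` are in the first four real registers, and everything else
is `0`. -/
def initial (θ : Setting) : Store where
  nreg := fun _ => 0
  rreg := fun r => if r = 0 then θ.p else if r = 1 then θ.ε else if r = 2 then θ.α
    else if r = 3 then θ.δ else 0
  nmem := fun _ _ => 0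
  rmem := fun _ _ => 0

/-- The algorithm is told the result of a toss: the coin is put into register `0` and the outcome
(`1` for heads, `0` for tails) into register `1`. -/
def receive (s : Store) (i : ℕ) (b : Bool) : Store := (s.setN 0 i).setN 1 b.toNat

/-- The answer of the algorithm: register `2` says whether to toss (`0`) or to output (any other
value), register `3` names the coin. -/
def answer (s : Store) : Move :=
  if s.nreg 2 = 0 then .toss (s.nreg 3) else .output (s.nreg 3)

end Store

/-- `A.Reaches θ h s t`: with the parameters `θ`, after the tosses of the history `h` have been
reported to the algorithm one by one, it is in the state `s`, and it took `t` units of time to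
digest the last toss and to find its answer (to find its first answer, if `h` is empty). -/
inductive OnlineAlgorithm.Reaches (A : OnlineAlgorithm) (θ : Setting) :
    History → Store → ℕ → Prop
  | start {s : Store} {t : ℕ} :
      Exec A.start (Store.initial θ) t s → Reaches A θ [] s t
  | next {h : History} {i : ℕ} {b : Bool} {s s' : Store} {t t' : ℕ} :
      Reaches A θ h s t → Exec A.next (s.receive i b) t' s' →
      Reaches A θ ((i, b) :: h) s' t'

end CoinLearning

end

open CoinLearning

/-!
The proof has two independent parts.

Optimality. Given the history, the coins are independent, and the state of a coin is its number of
heads and tails; an admissible strategy has to toss until some coin is heavy with conditional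
probability at least `1 - δ`, which means that its likelihood ratio has reached the threshold. This
is a multi-armed bandit, and the proof follows Whittle. Consider a single coin that may be quit at
a cost `m` before it reaches the target. Its optimal value `quitValue s m` is concave in `m`, solves
a Bellman equation, and is antitone in the probability that the coin is heavy
(`quitValue_antitone_post`). Its right derivative `quitProb s m` is the probability of quitting. The
infinite supply of fresh coins acts as an option to quit at the cost `freshIndex`, the largest
quitting cost at which a fresh coin is not worth a toss, and the optimal value of the whole
collection is `jointValue`, the integral of `∏ i, quitProb (x i) m` over `0 ≤ m ≤ freshIndex`.

When coin `i` is tossed, the expected decrease of `jointValue` is the integral of the decrease of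
`quitProb` of coin `i` against the antitone weight given by the other coins. The partial integrals
of the decrease without the weight are at most `1` by the Bellman equation of the single coin, so
the decrease is at most `1` (`integral_antitone_mul_le_one`, `jointValue_le_one_add`). If coin `i`
is most likely to be heavy and has not reached the target, then the weight is `1` wherever the
integrand does not vanish, and the decrease is exactly `1` (`jointValue_eq_one_add`).

As `jointValue` is bounded and vanishes when a coin has reached the target, it is a lower bound for
the cost of admissible strategies (`value_le_cost`) and an upper bound for the cost of
Likelihood-Toss (`IsLikelihoodToss.cost_le`). Finite cost forces Likelihood-Toss to stop almost
surely, and the correctness at each stopping history gives the probability of success.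

Running time. The algorithm keeps the tossed coins in the nodes `1, …, n` of an implicit binary
tree, in the order of their first tosses. Each node stores the conditional probability of its own
coin to be heavy and the best coin of its subtree. A toss changes the key of one node, and only the
nodes on its path to the root are recomputed. The best coin at the root competes with the fresh coin
whose number exceeds those of all tossed coins by one.
-/

noncomputable section

namespace CoinLearning

/-! ### The statistics of a single coin -/

/-- The state of a coin with `s.1` heads and `s.2` tails, after one more toss with outcome `b`. -/
def record (s : ℕ × ℕ) : Bool → ℕ × ℕ
  | true => (s.1 + 1, s.2)
  | false => (s.1, s.2 + 1)

namespace Setting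

variable (θ : Setting)

/-- The probability that a coin is heavy and that given tosses of it show `s.1` heads and
`s.2` tails, in a given order. -/
def heavyWeight (s : ℕ × ℕ) : ℝ := θ.α * ((θ.p + θ.ε) ^ s.1 * (1 - θ.p - θ.ε) ^ s.2)

/-- The probability that a coin is not heavy and that given tosses of it show `s.1` heads and
`s.2` tails, in a given order. -/
def lightWeight (s : ℕ × ℕ) : ℝ := (1 - θ.α) * ((θ.p - θ.ε) ^ s.1 * (1 - θ.p + θ.ε) ^ s.2)

/-- The probability that given tosses of a coin show `s.1` heads and `s.2` tails, in a given
order. -/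
def weight (s : ℕ × ℕ) : ℝ := θ.heavyWeight s + θ.lightWeight s

/-- The probability that the next toss of a coin in the state `s` shows `b`. -/
def pred (s : ℕ × ℕ) (b : Bool) : ℝ := θ.weight (record s b) / θ.weight s

/-- The conditional probability that a coin in the state `s` is heavy. -/
def post (s : ℕ × ℕ) : ℝ := θ.heavyWeight s / θ.weight s

lemma heavyWeight_nonneg (s : ℕ × ℕ) : 0 ≤ θ.heavyWeight s := by
  have h1 : 0 ≤ θ.p + θ.ε := by linarith [θ.ε_pos, θ.ε_le_p]
  have h2 : 0 ≤ 1 - θ.p - θ.ε := by linarith [θ.p_le]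
  have := θ.α_pos
  unfold heavyWeight
  positivity

lemma lightWeight_nonneg (s : ℕ × ℕ) : 0 ≤ θ.lightWeight s := by
  have h1 : 0 ≤ θ.p - θ.ε := by linarith [θ.ε_le_p]
  have h2 : 0 ≤ 1 - θ.p + θ.ε := by linarith [θ.p_le, θ.ε_pos]
  have : 0 ≤ 1 - θ.α := by linarith [θ.α_lt]
  unfold lightWeight
  positivity

lemma heavyWeight_pos_of_lt (h : θ.p < 1 - θ.ε) (s : ℕ × ℕ) : 0 < θ.heavyWeight s := by
  have h1 : 0 < θ.p + θ.ε := by linarith [θ.ε_pos, θ.ε_le_p]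
  have h2 : 0 < 1 - θ.p - θ.ε := by linarith
  have := θ.α_pos
  unfold heavyWeight
  positivity

lemma lightWeight_pos_of_lt (h : θ.ε < θ.p) (s : ℕ × ℕ) : 0 < θ.lightWeight s := by
  have h1 : 0 < θ.p - θ.ε := by linarith
  have h2 : 0 < 1 - θ.p + θ.ε := by linarith [θ.p_le, θ.ε_pos]
  have : 0 < 1 - θ.α := by linarith [θ.α_lt]
  unfold lightWeight
  positivity

/-- Every sequence of outcomes has positive probability: as `ε < 1 / 2`, the extreme cases `p = ε`
and `p = 1 - ε` exclude each other. -/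
lemma weight_pos (s : ℕ × ℕ) : 0 < θ.weight s := by
  unfold weight
  rcases lt_or_ge θ.ε θ.p with h | h
  · exact add_pos_of_nonneg_of_pos (θ.heavyWeight_nonneg s) (θ.lightWeight_pos_of_lt h s)
  · refine add_pos_of_pos_of_nonneg (θ.heavyWeight_pos_of_lt ?_ s) (θ.lightWeight_nonneg s)
    linarith [θ.ε_lt]

lemma heavyWeight_record_true (s : ℕ × ℕ) :
    θ.heavyWeight (record s true) = θ.heavyWeight s * (θ.p + θ.ε) := by
  simp only [heavyWeight, record]; ring

lemma heavyWeight_record_false (s : ℕ × ℕ) :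
    θ.heavyWeight (record s false) = θ.heavyWeight s * (1 - θ.p - θ.ε) := by
  simp only [heavyWeight, record]; ring

lemma lightWeight_record_true (s : ℕ × ℕ) :
    θ.lightWeight (record s true) = θ.lightWeight s * (θ.p - θ.ε) := by
  simp only [lightWeight, record]; ring

lemma lightWeight_record_false (s : ℕ × ℕ) :
    θ.lightWeight (record s false) = θ.lightWeight s * (1 - θ.p + θ.ε) := by
  simp only [lightWeight, record]; ring

lemma weight_record_add (s : ℕ × ℕ) :
    θ.weight (record s true) + θ.weight (record s false) = θ.weight s := by
  simp only [weight, heavyWeight_record_true, heavyWeight_record_false, lightWeight_record_true,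
    lightWeight_record_false]
  ring

lemma pred_pos (s : ℕ × ℕ) (b : Bool) : 0 < θ.pred s b :=
  div_pos (θ.weight_pos _) (θ.weight_pos _)

lemma pred_true_add_pred_false (s : ℕ × ℕ) : θ.pred s true + θ.pred s false = 1 := by
  rw [pred, pred, ← add_div, weight_record_add, div_self (θ.weight_pos s).ne']

lemma post_le_post_iff (s t : ℕ × ℕ) :
    θ.post s ≤ θ.post t ↔
      θ.heavyWeight s * θ.lightWeight t ≤ θ.heavyWeight t * θ.lightWeight s := by
  rw [post, post, div_le_div_iff₀ (θ.weight_pos s) (θ.weight_pos t), weight, weight]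
  constructor <;> intro h <;> linarith [mul_comm (θ.heavyWeight s) (θ.heavyWeight t)]

lemma post_record_mono {s t : ℕ × ℕ} (h : θ.post s ≤ θ.post t) (b : Bool) :
    θ.post (record s b) ≤ θ.post (record t b) := by
  rw [post_le_post_iff] at h ⊢
  have hp1 : 0 ≤ θ.p + θ.ε := by linarith [θ.ε_pos, θ.ε_le_p]
  have hp2 : 0 ≤ θ.p - θ.ε := by linarith [θ.ε_le_p]
  have hp3 : 0 ≤ 1 - θ.p - θ.ε := by linarith [θ.p_le]
  have hp4 : 0 ≤ 1 - θ.p + θ.ε := by linarith [θ.p_le, θ.ε_pos]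
  cases b
  · simp only [heavyWeight_record_false, lightWeight_record_false]
    have := mul_le_mul_of_nonneg_right h (mul_nonneg hp3 hp4)
    linarith
  · simp only [heavyWeight_record_true, lightWeight_record_true]
    have := mul_le_mul_of_nonneg_right h (mul_nonneg hp1 hp2)
    linarith

lemma post_record_false_le_true (s : ℕ × ℕ) :
    θ.post (record s false) ≤ θ.post (record s true) := by
  rw [post_le_post_iff]
  simp only [heavyWeight_record_false, lightWeight_record_false, heavyWeight_record_true,
    lightWeight_record_true]
  have h := mul_nonneg (θ.heavyWeight_nonneg s) (θ.lightWeight_nonneg s)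
  have := mul_nonneg h θ.ε_pos.le
  nlinarith

lemma pred_true_mono {s t : ℕ × ℕ} (h : θ.post s ≤ θ.post t) :
    θ.pred s true ≤ θ.pred t true := by
  rw [post_le_post_iff] at h
  rw [pred, pred, div_le_div_iff₀ (θ.weight_pos s) (θ.weight_pos t)]
  simp only [weight, heavyWeight_record_true, lightWeight_record_true]
  nlinarith [mul_le_mul_of_nonneg_right h θ.ε_pos.le]

lemma post_zero : θ.post (0, 0) = θ.α := by
  simp [post, weight, heavyWeight, lightWeight]

/-- Bayes' rule for a head. -/
lemma post_record_true (t : ℕ × ℕ) :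
    θ.post t * (θ.p + θ.ε) / (θ.post t * (θ.p + θ.ε) + (1 - θ.post t) * (θ.p - θ.ε)) =
      θ.post (record t true) := by
  have h1 := θ.weight_pos t
  have h2 := θ.weight_pos (record t true)
  simp only [post, weight, heavyWeight_record_true, lightWeight_record_true] at *
  have e : 1 - θ.heavyWeight t / (θ.heavyWeight t + θ.lightWeight t) =
      θ.lightWeight t / (θ.heavyWeight t + θ.lightWeight t) := by field_simp; ring
  rw [e, div_mul_eq_mul_div, div_mul_eq_mul_div, ← add_div, div_div_div_cancel_right₀ h1.ne']

/-- Bayes' rule for a tail. -/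
lemma post_record_false (t : ℕ × ℕ) :
    θ.post t * (1 - (θ.p + θ.ε)) /
        (θ.post t * (1 - (θ.p + θ.ε)) + (1 - θ.post t) * (1 - (θ.p - θ.ε))) =
      θ.post (record t false) := by
  have h1 := θ.weight_pos t
  simp only [post, weight, heavyWeight_record_false, lightWeight_record_false] at *
  have e : 1 - θ.heavyWeight t / (θ.heavyWeight t + θ.lightWeight t) =
      θ.lightWeight t / (θ.heavyWeight t + θ.lightWeight t) := by field_simp; ring
  rw [e, div_mul_eq_mul_div, div_mul_eq_mul_div, ← add_div, div_div_div_cancel_right₀ h1.ne',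
    show 1 - (θ.p + θ.ε) = 1 - θ.p - θ.ε by ring, show 1 - (θ.p - θ.ε) = 1 - θ.p + θ.ε by ring]

/-- Enough heads in a row, starting from a fresh coin, make any confidence below `1` reached. -/
lemma exists_le_post_heads : ∃ k : ℕ, 1 - θ.δ ≤ θ.post (k, 0) := by
  have hpos : 0 < θ.p + θ.ε := by linarith [θ.ε_pos, θ.ε_le_p]
  have hα := θ.α_pos
  have hlim : Filter.Tendsto (fun k : ℕ => (1 - θ.α) * ((θ.p - θ.ε) / (θ.p + θ.ε)) ^ k)
      Filter.atTop (nhds ((1 - θ.α) * 0)) := by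
    refine (tendsto_pow_atTop_nhds_zero_of_lt_one ?_ ?_).const_mul _
    · exact div_nonneg (by linarith [θ.ε_le_p]) hpos.le
    · rw [div_lt_one hpos]; linarith [θ.ε_pos]
  rw [mul_zero] at hlim
  obtain ⟨k, hk⟩ := (hlim.eventually (gt_mem_nhds (mul_pos hα θ.δ_pos))).exists
  refine ⟨k, ?_⟩
  rw [post, le_div_iff₀ (θ.weight_pos _)]
  have hl : θ.lightWeight (k, 0) ≤ θ.δ * θ.heavyWeight (k, 0) := by
    simp only [lightWeight, heavyWeight, pow_zero, mul_one]
    rw [div_pow, ← mul_div_assoc, div_lt_iff₀ (pow_pos hpos k)] at hk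
    nlinarith
  have h0 := mul_nonneg θ.δ_pos.le (θ.lightWeight_nonneg (k, 0))
  rw [weight]
  nlinarith

/-! ### One coin with the option to quit -/

/-- Value iteration for the problem of a single coin in the state `s`: a toss costs `1`, stopping
is free once the coin is heavy with probability at least `1 - δ`, and quitting before costs `m`. -/
def quitIter : ℕ → ℕ × ℕ → ℝ → ℝ
  | 0, s, m => if 1 - θ.δ ≤ θ.post s then 0 else m
  | n + 1, s, m => if 1 - θ.δ ≤ θ.post s then 0 else
      min m (1 + (θ.pred s true * quitIter n (record s true) m +
        θ.pred s false * quitIter n (record s false) m))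

/-- The least expected cost of a single coin in the state `s`, when a toss costs `1`, stopping
is free once the coin is heavy with probability at least `1 - δ`, and quitting before costs `m`. -/
def quitValue (s : ℕ × ℕ) (m : ℝ) : ℝ := ⨅ n, θ.quitIter n s m

/-- The expected value of a function of the state of a coin after its next toss. -/
def expNext (f : ℕ × ℕ → ℝ) (s : ℕ × ℕ) : ℝ :=
  θ.pred s true * f (record s true) + θ.pred s false * f (record s false)

lemma expNext_mono {f g : ℕ × ℕ → ℝ} (h : ∀ s, f s ≤ g s) (s : ℕ × ℕ) :
    θ.expNext f s ≤ θ.expNext g s :=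
  add_le_add (mul_le_mul_of_nonneg_left (h _) (θ.pred_pos _ _).le)
    (mul_le_mul_of_nonneg_left (h _) (θ.pred_pos _ _).le)

lemma expNext_const (c : ℝ) (s : ℕ × ℕ) : θ.expNext (fun _ => c) s = c := by
  rw [expNext, ← add_mul, pred_true_add_pred_false, one_mul]

/-- The outcome of a toss is ordered in the same way as the states: a coin that is more likely to be
heavy moves, in the sense of stochastic dominance, to states that are more likely to be heavy. -/
lemma expNext_antitone {f : ℕ × ℕ → ℝ} (hf : ∀ s t, θ.post s ≤ θ.post t → f t ≤ f s)
    {s t : ℕ × ℕ} (h : θ.post s ≤ θ.post t) : θ.expNext f t ≤ θ.expNext f s := by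
  have h1 := hf _ _ (θ.post_record_mono h true)
  have h2 := hf _ _ (θ.post_record_mono h false)
  have h3 := hf _ _ (θ.post_record_false_le_true t)
  have h4 := θ.pred_true_mono h
  have hs := θ.pred_true_add_pred_false s
  have ht := θ.pred_true_add_pred_false t
  have h5 := mul_le_mul_of_nonneg_left h1 (θ.pred_pos s true).le
  have h6 := mul_le_mul_of_nonneg_left h2 (θ.pred_pos s false).le
  have h7 := mul_nonneg (sub_nonneg.2 h4) (sub_nonneg.2 h3)
  have e1 : θ.pred s false = 1 - θ.pred s true := by linarith
  have e2 : θ.pred t false = 1 - θ.pred t true := by linarith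
  unfold expNext
  rw [e1] at h6 ⊢
  rw [e2]
  nlinarith

lemma quitIter_succ (n : ℕ) (s : ℕ × ℕ) (m : ℝ) :
    θ.quitIter (n + 1) s m = if 1 - θ.δ ≤ θ.post s then 0 else
      min m (1 + θ.expNext (fun s => θ.quitIter n s m) s) := rfl

lemma quitIter_of_target {s : ℕ × ℕ} (h : 1 - θ.δ ≤ θ.post s) (n : ℕ) (m : ℝ) :
    θ.quitIter n s m = 0 := by
  cases n <;> simp [quitIter, h]

lemma quitIter_succ_le (n : ℕ) (s : ℕ × ℕ) (m : ℝ) :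
    θ.quitIter (n + 1) s m ≤ θ.quitIter n s m := by
  induction n generalizing s with
  | zero =>
    rw [quitIter_succ, quitIter]
    split_ifs
    · exact le_rfl
    · exact min_le_left _ _
  | succ n ih =>
    rw [quitIter_succ, quitIter_succ]
    split_ifs
    · exact le_rfl
    · exact min_le_min_left _ (add_le_add_right (θ.expNext_mono ih s) 1)

lemma le_quitIter (n : ℕ) (s : ℕ × ℕ) (m : ℝ) : min m 0 ≤ θ.quitIter n s m := by
  induction n generalizing s with
  | zero =>
    rw [quitIter]
    split_ifs
    · exact min_le_right _ _
    · exact min_le_left _ _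
  | succ n ih =>
    rw [quitIter_succ]
    split_ifs
    · exact min_le_right _ _
    · refine le_min (min_le_left _ _) ?_
      have := θ.expNext_mono ih s
      rw [expNext_const] at this
      linarith

lemma tendsto_quitIter (s : ℕ × ℕ) (m : ℝ) :
    Filter.Tendsto (fun n => θ.quitIter n s m) Filter.atTop (nhds (θ.quitValue s m)) :=
  tendsto_atTop_ciInf (antitone_nat_of_succ_le fun n => θ.quitIter_succ_le n s m)
    ⟨min m 0, by rintro _ ⟨n, rfl⟩; exact θ.le_quitIter n s m⟩

lemma tendsto_expNext_quitIter (s : ℕ × ℕ) (m : ℝ) :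
    Filter.Tendsto (fun n => θ.expNext (fun s => θ.quitIter n s m) s) Filter.atTop
      (nhds (θ.expNext (fun s => θ.quitValue s m) s)) :=
  ((θ.tendsto_quitIter _ m).const_mul _).add ((θ.tendsto_quitIter _ m).const_mul _)

lemma quitValue_of_target {s : ℕ × ℕ} (h : 1 - θ.δ ≤ θ.post s) (m : ℝ) :
    θ.quitValue s m = 0 := by
  simp [quitValue, θ.quitIter_of_target h]

/-- The Bellman equation of the single coin. -/
lemma quitValue_of_not_target {s : ℕ × ℕ} (h : ¬ 1 - θ.δ ≤ θ.post s) (m : ℝ) :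
    θ.quitValue s m = min m (1 + θ.expNext (fun s => θ.quitValue s m) s) := by
  have h1 := (Filter.tendsto_add_atTop_iff_nat 1).2 (θ.tendsto_quitIter s m)
  simp only [quitIter_succ, h, if_false] at h1
  exact tendsto_nhds_unique h1
    (tendsto_const_nhds.min (tendsto_const_nhds.add (θ.tendsto_expNext_quitIter s m)))

lemma quitValue_nonneg (s : ℕ × ℕ) {m : ℝ} (hm : 0 ≤ m) : 0 ≤ θ.quitValue s m :=
  ge_of_tendsto' (θ.tendsto_quitIter s m) fun n => by
    simpa [min_eq_right hm] using θ.le_quitIter n s m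

lemma quitValue_le (s : ℕ × ℕ) {m : ℝ} (hm : 0 ≤ m) : θ.quitValue s m ≤ m := by
  by_cases h : 1 - θ.δ ≤ θ.post s
  · rwa [quitValue_of_target θ h]
  · rw [quitValue_of_not_target θ h]; exact min_le_left _ _

lemma expNext_quitValue_nonneg (s : ℕ × ℕ) {m : ℝ} (hm : 0 ≤ m) :
    0 ≤ θ.expNext (fun s => θ.quitValue s m) s :=
  add_nonneg (mul_nonneg (θ.pred_pos _ _).le (θ.quitValue_nonneg _ hm))
    (mul_nonneg (θ.pred_pos _ _).le (θ.quitValue_nonneg _ hm))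

lemma quitValue_le_one_add (s : ℕ × ℕ) {m : ℝ} (hm : 0 ≤ m) :
    θ.quitValue s m ≤ 1 + θ.expNext (fun s => θ.quitValue s m) s := by
  by_cases h : 1 - θ.δ ≤ θ.post s
  · rw [quitValue_of_target θ h]
    linarith [θ.expNext_quitValue_nonneg s hm]
  · conv_lhs => rw [quitValue_of_not_target θ h]
    exact min_le_right _ _

lemma quitValue_eq_one_add {s : ℕ × ℕ} (h : ¬ 1 - θ.δ ≤ θ.post s) {m : ℝ}
    (hm : θ.quitValue s m < m) :
    θ.quitValue s m = 1 + θ.expNext (fun s => θ.quitValue s m) s := by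
  rw [quitValue_of_not_target θ h] at hm ⊢
  exact min_eq_right ((min_lt_iff.1 hm).resolve_left (lt_irrefl _)).le

lemma quitIter_antitone_post (n : ℕ) {m : ℝ} (hm : 0 ≤ m) {s t : ℕ × ℕ}
    (h : θ.post s ≤ θ.post t) : θ.quitIter n t m ≤ θ.quitIter n s m := by
  induction n generalizing s t with
  | zero =>
    simp only [quitIter]
    split_ifs with h1 h2
    · exact le_rfl
    · exact hm
    · linarith
    · exact le_rfl
  | succ n ih =>
    by_cases h1 : 1 - θ.δ ≤ θ.post t
    · rw [quitIter_of_target θ h1]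
      simpa [min_eq_right hm] using θ.le_quitIter (n + 1) s m
    · have h2 : ¬ 1 - θ.δ ≤ θ.post s := fun h2 => h1 (h2.trans h)
      rw [quitIter_succ, quitIter_succ, if_neg h1, if_neg h2]
      exact min_le_min_left _
        (add_le_add_right (θ.expNext_antitone (fun s t hst => ih hst) h) 1)

/-- A coin that is more likely to be heavy costs no more. -/
lemma quitValue_antitone_post {m : ℝ} (hm : 0 ≤ m) {s t : ℕ × ℕ}
    (h : θ.post s ≤ θ.post t) : θ.quitValue t m ≤ θ.quitValue s m :=
  le_of_tendsto_of_tendsto' (θ.tendsto_quitIter t m) (θ.tendsto_quitIter s m)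
    fun n => θ.quitIter_antitone_post n hm h

lemma quitIter_mono (n : ℕ) (s : ℕ × ℕ) {m m' : ℝ} (h : m ≤ m') :
    θ.quitIter n s m ≤ θ.quitIter n s m' ∧ θ.quitIter n s m' ≤ θ.quitIter n s m + (m' - m) := by
  induction n generalizing s with
  | zero =>
    simp only [quitIter]
    split_ifs
    · constructor <;> linarith
    · constructor <;> linarith
  | succ n ih =>
    simp only [quitIter_succ]
    split_ifs
    · constructor <;> linarith
    · have h1 := θ.expNext_mono (fun s => (ih s).1) s
      have h2 := θ.expNext_mono (fun s => (ih s).2) s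
      have h3 : θ.expNext (fun s => θ.quitIter n s m + (m' - m)) s =
          θ.expNext (fun s => θ.quitIter n s m) s + (m' - m) := by
        have := θ.expNext_const (m' - m) s
        simp only [expNext] at this ⊢
        linarith
      rw [h3] at h2
      refine ⟨min_le_min h (by linarith), ?_⟩
      rw [← min_add_add_right]
      exact min_le_min (by linarith) (by linarith)

lemma quitValue_mono (s : ℕ × ℕ) : Monotone (θ.quitValue s) := fun m m' h =>
  le_of_tendsto_of_tendsto' (θ.tendsto_quitIter s m) (θ.tendsto_quitIter s m')
    fun n => (θ.quitIter_mono n s h).1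

lemma quitValue_le_add (s : ℕ × ℕ) {m m' : ℝ} (h : m ≤ m') :
    θ.quitValue s m' ≤ θ.quitValue s m + (m' - m) :=
  le_of_tendsto_of_tendsto' (θ.tendsto_quitIter s m') ((θ.tendsto_quitIter s m).add_const _)
    fun n => (θ.quitIter_mono n s h).2

lemma concaveOn_quitIter (n : ℕ) (s : ℕ × ℕ) : ConcaveOn ℝ Set.univ (θ.quitIter n s) := by
  induction n generalizing s with
  | zero =>
    by_cases h : 1 - θ.δ ≤ θ.post s
    · have : θ.quitIter 0 s = fun _ => 0 := by funext m; simp [quitIter, h]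
      rw [this]
      exact concaveOn_const 0 convex_univ
    · have : θ.quitIter 0 s = id := by funext m; simp [quitIter, h]
      rw [this]
      exact concaveOn_id convex_univ
  | succ n ih =>
    by_cases h : 1 - θ.δ ≤ θ.post s
    · have : θ.quitIter (n + 1) s = fun _ => 0 := by funext m; simp [quitIter, h]
      rw [this]
      exact concaveOn_const 0 convex_univ
    · have : θ.quitIter (n + 1) s = id ⊓ ((fun _ => 1) +
          (θ.pred s true • θ.quitIter n (record s true) +
            θ.pred s false • θ.quitIter n (record s false))) := by
        funext m; simp [quitIter, h]
      rw [this]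
      exact (concaveOn_id convex_univ).inf ((concaveOn_const 1 convex_univ).add
        (((ih _).smul (θ.pred_pos _ _).le).add ((ih _).smul (θ.pred_pos _ _).le)))

lemma concaveOn_quitValue (s : ℕ × ℕ) : ConcaveOn ℝ Set.univ (θ.quitValue s) := by
  refine ⟨convex_univ, fun x _ y _ a b ha hb hab => ?_⟩
  refine le_of_tendsto_of_tendsto' (((θ.tendsto_quitIter s x).const_smul a).add
    ((θ.tendsto_quitIter s y).const_smul b)) (θ.tendsto_quitIter s _) fun n => ?_
  exact (θ.concaveOn_quitIter n s).2 trivial trivial ha hb hab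

lemma continuous_quitValue (s : ℕ × ℕ) : Continuous (θ.quitValue s) := by
  refine LipschitzWith.continuous (K := 1) (LipschitzWith.of_le_add fun x y => ?_)
  rcases le_total x y with h | h
  · exact (θ.quitValue_mono s h).trans (le_add_of_nonneg_right dist_nonneg)
  · have := θ.quitValue_le_add s h
    rwa [Real.dist_eq, abs_of_nonneg (sub_nonneg.2 h)]

/-- If quitting is optimal at the quitting cost `m'`, then also at every smaller one. -/
lemma quitValue_eq_self_of_le (s : ℕ × ℕ) {m m' : ℝ} (hm : 0 ≤ m) (h : m ≤ m')
    (h' : θ.quitValue s m' = m') : θ.quitValue s m = m := by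
  have h1 := θ.quitValue_le s hm
  have h2 := θ.quitValue_le_add s h
  linarith

/-- The probability of quitting under the best policy with quitting cost `m`, as the right
derivative of the value. -/
def quitProb (s : ℕ × ℕ) (m : ℝ) : ℝ := derivWithin (θ.quitValue s) (Set.Ioi m) m

lemma hasDerivWithinAt_quitValue (s : ℕ × ℕ) (m : ℝ) :
    HasDerivWithinAt (θ.quitValue s) (θ.quitProb s m) (Set.Ioi m) m := by
  have h := (θ.concaveOn_quitValue s).neg.hasDerivWithinAt_rightDeriv_of_mem_interior
    (x := m) (by simp)
  have h2 := h.neg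
  rw [neg_neg] at h2
  exact h2.differentiableWithinAt.hasDerivWithinAt

lemma antitone_quitProb (s : ℕ × ℕ) : Antitone (θ.quitProb s) := by
  have h := (θ.concaveOn_quitValue s).neg.monotoneOn_rightDeriv
  rw [interior_univ, monotoneOn_univ] at h
  intro x y hxy
  have := h hxy
  simp only [derivWithin.neg] at this
  exact neg_le_neg_iff.1 this

lemma quitProb_nonneg (s : ℕ × ℕ) (m : ℝ) : 0 ≤ θ.quitProb s m :=
  ((θ.quitValue_mono s).monotoneOn _).derivWithin_nonneg

lemma quitProb_le_one (s : ℕ × ℕ) (m : ℝ) : θ.quitProb s m ≤ 1 := by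
  have h1 : HasDerivWithinAt (fun x => x - θ.quitValue s x) (1 - θ.quitProb s m) (Set.Ioi m) m :=
    (hasDerivWithinAt_id m _).sub (θ.hasDerivWithinAt_quitValue s m)
  have h2 : Monotone fun x => x - θ.quitValue s x := fun x y hxy => by
    have := θ.quitValue_le_add s hxy
    dsimp only
    linarith
  have h3 := (h2.monotoneOn (Set.Ioi m)).derivWithin_nonneg (x := m)
  rw [h1.derivWithin (uniqueDiffWithinAt_Ioi m)] at h3
  linarith

lemma quitProb_of_target {s : ℕ × ℕ} (h : 1 - θ.δ ≤ θ.post s) (m : ℝ) : θ.quitProb s m = 0 := by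
  have : θ.quitValue s = fun _ => 0 := funext (θ.quitValue_of_target h)
  simp [quitProb, this]

/-- Quitting is certain below every quitting cost at which quitting is optimal. -/
lemma quitProb_eq_one {s : ℕ × ℕ} {m m' : ℝ} (hm : 0 ≤ m) (h : m < m')
    (h' : θ.quitValue s m' = m') : θ.quitProb s m = 1 := by
  have h1 : HasDerivWithinAt (θ.quitValue s) 1 (Set.Ioi m) m := by
    refine (hasDerivWithinAt_id m _).congr_of_eventuallyEq ?_
      (θ.quitValue_eq_self_of_le s hm h.le h')
    filter_upwards [Ioc_mem_nhdsGT h] with x hx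
    exact θ.quitValue_eq_self_of_le s (hm.trans hx.1.le) hx.2 h'
  exact h1.derivWithin (uniqueDiffWithinAt_Ioi m)

/-- If quitting is not optimal at any larger quitting cost, then the probability of quitting is the
average of those after the next toss. -/
lemma quitProb_eq_expNext {s : ℕ × ℕ} (hs : ¬ 1 - θ.δ ≤ θ.post s) {m : ℝ}
    (h : ∀ m', m < m' → θ.quitValue s m' < m') :
    θ.quitProb s m = θ.expNext (fun s => θ.quitProb s m) s := by
  have h1 : HasDerivWithinAt (fun x => 1 + θ.expNext (fun s => θ.quitValue s x) s)
      (θ.expNext (fun s => θ.quitProb s m) s) (Set.Ioi m) m :=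
    (((θ.hasDerivWithinAt_quitValue _ m).const_mul _).add
      ((θ.hasDerivWithinAt_quitValue _ m).const_mul _)).const_add 1
  have hev : ∀ x ∈ Set.Ioi m, θ.quitValue s x = 1 + θ.expNext (fun s => θ.quitValue s x) s :=
    fun x hx => θ.quitValue_eq_one_add hs (h x hx)
  have hc : ContinuousWithinAt (θ.quitValue s) (Set.Ioi m) m :=
    (θ.continuous_quitValue s).continuousWithinAt
  have hm : θ.quitValue s m = 1 + θ.expNext (fun s => θ.quitValue s m) s :=
    tendsto_nhds_unique hc.tendsto
      (h1.continuousWithinAt.tendsto.congr' (by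
        filter_upwards [self_mem_nhdsWithin] with x hx using (hev x hx).symm))
  exact (h1.congr hev hm).derivWithin (uniqueDiffWithinAt_Ioi m)

lemma integral_quitProb (s : ℕ × ℕ) {g : ℝ} (hg : 0 ≤ g) :
    ∫ m in (0 : ℝ)..g, θ.quitProb s m = θ.quitValue s g := by
  rw [intervalIntegral.integral_eq_sub_of_hasDeriv_right_of_le hg
    (θ.continuous_quitValue s).continuousOn
    (fun x _ => θ.hasDerivWithinAt_quitValue s x) (θ.antitone_quitProb s).intervalIntegrable]
  have h0 : θ.quitValue s 0 = 0 := le_antisymm (θ.quitValue_le s le_rfl)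
    (θ.quitValue_nonneg s le_rfl)
  rw [h0, sub_zero]

/-! ### The index of a fresh coin -/

/-- The largest quitting cost at which it is optimal to quit a fresh coin at once. -/
def freshIndex : ℝ := sSup {m | 0 ≤ m ∧ θ.quitValue (0, 0) m = m}

/-- Tossing a fresh coin until it shows tails or reaches the target takes a bounded number of tosses
and succeeds with positive probability. This is better than quitting at once if quitting is
expensive. -/
lemma exists_quitValue_lt : ∃ m, 0 ≤ m ∧ θ.quitValue (0, 0) m < m := by
  obtain ⟨k, hk⟩ := θ.exists_le_post_heads
  have key : ∀ j ≤ k, ∃ A c : ℝ, 0 < c ∧ ∀ m, 0 ≤ m →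
      θ.quitValue (k - j, 0) m ≤ A + (1 - c) * m := by
    intro j
    induction j with
    | zero =>
      refine fun _ => ⟨0, 1, one_pos, fun m hm => ?_⟩
      rw [Nat.sub_zero, quitValue_of_target θ hk]
      simp
    | succ j ih =>
      intro hj
      obtain ⟨A, c, hc, hA⟩ := ih (by omega)
      have hr : record (k - (j + 1), 0) true = (k - j, 0) := by
        simp only [record, Prod.mk.injEq, and_true]; omega
      refine ⟨1 + θ.pred (k - (j + 1), 0) true * A, θ.pred (k - (j + 1), 0) true * c,
        mul_pos (θ.pred_pos _ _) hc, fun m hm => ?_⟩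
      have h1 := θ.quitValue_le_one_add (k - (j + 1), 0) hm
      rw [expNext, hr] at h1
      have h2 := mul_le_mul_of_nonneg_left (hA m hm) (θ.pred_pos (k - (j + 1), 0) true).le
      have h3 := mul_le_mul_of_nonneg_left (θ.quitValue_le (record (k - (j + 1), 0) false) hm)
        (θ.pred_pos (k - (j + 1), 0) false).le
      have h4 : θ.pred (k - (j + 1), 0) false = 1 - θ.pred (k - (j + 1), 0) true := by
        linarith [θ.pred_true_add_pred_false (k - (j + 1), 0)]
      rw [h4] at h1 h3
      linarith
  obtain ⟨A, c, hc, hA⟩ := key k le_rfl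
  rw [Nat.sub_self] at hA
  refine ⟨(|A| + 1) / c, by positivity, (hA _ (by positivity)).trans_lt ?_⟩
  have : c * ((|A| + 1) / c) = |A| + 1 := by field_simp
  linarith [le_abs_self A]

lemma bddAbove_fresh : BddAbove {m | 0 ≤ m ∧ θ.quitValue (0, 0) m = m} := by
  obtain ⟨m, hm, hlt⟩ := θ.exists_quitValue_lt
  refine ⟨m, fun x hx => ?_⟩
  by_contra! h
  exact hlt.ne (θ.quitValue_eq_self_of_le _ hm h.le hx.2)

lemma freshIndex_nonneg : 0 ≤ θ.freshIndex :=
  le_csSup θ.bddAbove_fresh ⟨le_rfl, le_antisymm (θ.quitValue_le _ le_rfl)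
    (θ.quitValue_nonneg _ le_rfl)⟩

lemma quitValue_fresh_lt {m : ℝ} (h : θ.freshIndex < m) : θ.quitValue (0, 0) m < m := by
  have hm := θ.freshIndex_nonneg.trans h.le
  refine lt_of_le_of_ne (θ.quitValue_le _ hm) fun he => ?_
  exact absurd (le_csSup θ.bddAbove_fresh ⟨hm, he⟩) (not_le.2 h)

lemma quitProb_fresh {m : ℝ} (hm : 0 ≤ m) (h : m < θ.freshIndex) : θ.quitProb (0, 0) m = 1 := by
  have hne : {m | 0 ≤ m ∧ θ.quitValue (0, 0) m = m}.Nonempty :=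
    ⟨0, le_rfl, le_antisymm (θ.quitValue_le _ le_rfl) (θ.quitValue_nonneg _ le_rfl)⟩
  obtain ⟨m', hm', hlt⟩ := exists_lt_of_lt_csSup hne h
  exact θ.quitProb_eq_one hm hlt hm'.2

/-- A coin that is at least as likely to be heavy as a fresh one is worth another toss at the
quitting cost `freshIndex`. -/
lemma quitValue_freshIndex {s : ℕ × ℕ} (hs : ¬ 1 - θ.δ ≤ θ.post s)
    (h : θ.post (0, 0) ≤ θ.post s) :
    θ.quitValue s θ.freshIndex = 1 + θ.expNext (fun s => θ.quitValue s θ.freshIndex) s := by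
  have hc1 : Continuous (θ.quitValue s) := θ.continuous_quitValue s
  have hc2 : Continuous fun m => 1 + θ.expNext (fun s => θ.quitValue s m) s :=
    continuous_const.add ((continuous_const.mul (θ.continuous_quitValue _)).add
      (continuous_const.mul (θ.continuous_quitValue _)))
  have h1 := (hc1.continuousWithinAt (s := Set.Ioi θ.freshIndex) (x := θ.freshIndex)).tendsto
  have h2 := (hc2.continuousWithinAt (s := Set.Ioi θ.freshIndex) (x := θ.freshIndex)).tendsto
  refine tendsto_nhds_unique h1 (h2.congr' ?_)
  filter_upwards [self_mem_nhdsWithin] with m hm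
  have hm0 := θ.freshIndex_nonneg.trans (le_of_lt hm)
  exact (θ.quitValue_eq_one_add hs
    ((θ.quitValue_antitone_post hm0 h).trans_lt (θ.quitValue_fresh_lt hm))).symm

end Setting

/-! ### An integral inequality of Abel type -/

/-- An antitone weight with values in `[0, 1]` is a mixture of indicator functions of initial
segments, so weighting an integrand cannot push its integral above all of its partial integrals. -/
lemma integral_antitone_mul_le_one {W f : ℝ → ℝ} {G : ℝ} (hG : 0 ≤ G) (hW : Antitone W)
    (hW0 : ∀ m, 0 ≤ W m) (hW1 : ∀ m, W m ≤ 1) (hf : IntervalIntegrable f volume 0 G)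
    (h : ∀ g, 0 ≤ g → g ≤ G → ∫ m in (0 : ℝ)..g, f m ≤ 1) :
    ∫ m in (0 : ℝ)..G, W m * f m ≤ 1 := by
  have hlayer : ∀ m, W m * f m = ∫ t in Set.Ioc (0 : ℝ) 1, if t < W m then f m else 0 := by
    intro m
    have h1 : (fun t => if t < W m then f m else 0) = (Set.Iio (W m)).indicator fun _ => f m := by
      funext t; simp [Set.indicator_apply]
    have h2 : (Set.Iio (W m) ∩ Set.Ioc 0 1 : Set ℝ) =ᵐ[volume] Set.Ioc 0 (W m) := by
      have h3 : Set.Ioo 0 (W m) ⊆ Set.Iio (W m) ∩ Set.Ioc 0 1 :=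
        fun t ht => ⟨ht.2, ht.1, ht.2.le.trans (hW1 m)⟩
      have h4 : Set.Iio (W m) ∩ Set.Ioc 0 1 ⊆ Set.Ioo 0 (W m) := fun t ht => ⟨ht.2.1, ht.1⟩
      rw [Set.Subset.antisymm h4 h3]
      exact Ioo_ae_eq_Ioc
    rw [h1, integral_indicator measurableSet_Iio, Measure.restrict_restrict measurableSet_Iio,
      setIntegral_congr_set h2, setIntegral_const]
    simp [hW0 m]
  have hint : Integrable (Function.uncurry fun m t : ℝ => if t < W m then f m else 0)
      ((volume.restrict (Set.Ioc 0 G)).prod (volume.restrict (Set.Ioc 0 1))) := by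
    have h1 : Integrable (fun z : ℝ × ℝ => f z.1)
        ((volume.restrict (Set.Ioc 0 G)).prod (volume.restrict (Set.Ioc 0 1))) :=
      ((intervalIntegrable_iff_integrableOn_Ioc_of_le hG).1 hf).integrable.comp_fst _
    have h2 : MeasurableSet {z : ℝ × ℝ | z.2 < W z.1} :=
      measurableSet_lt measurable_snd (hW.measurable.comp measurable_fst)
    refine (h1.indicator h2).congr (Filter.Eventually.of_forall fun z => ?_)
    simp [Set.indicator_apply, Function.uncurry]
  have hinner : ∀ t, ∫ m in Set.Ioc 0 G, (if t < W m then f m else 0) ≤ 1 := by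
    intro t
    have hmeas : MeasurableSet {m | t < W m} := measurableSet_lt measurable_const hW.measurable
    have h1 : (fun m => if t < W m then f m else 0) = {m | t < W m}.indicator f := by
      funext m; simp [Set.indicator_apply]
    rw [h1, integral_indicator hmeas, Measure.restrict_restrict hmeas]
    rcases Set.eq_empty_or_nonempty ({m | t < W m} ∩ Set.Ioc 0 G) with he | hne
    · simp [he]
    · set c := sSup ({m | t < W m} ∩ Set.Ioc 0 G) with hc
      have hbdd : BddAbove ({m | t < W m} ∩ Set.Ioc 0 G) := ⟨G, fun m hm => hm.2.2⟩
      have hcG : c ≤ G := csSup_le hne fun m hm => hm.2.2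
      obtain ⟨m₀, hm₀⟩ := hne
      have hc0 : 0 ≤ c := hm₀.2.1.le.trans (le_csSup hbdd hm₀)
      have hae : ({m | t < W m} ∩ Set.Ioc 0 G : Set ℝ) =ᵐ[volume] Set.Ioc 0 c := by
        have hnc : ∀ᵐ m : ℝ, m ≠ c := by simp [ae_iff]
        refine Filter.eventuallyEq_set.2 (hnc.mono fun m hm => ⟨fun h => ⟨h.2.1, ?_⟩, fun h => ?_⟩)
        · exact le_csSup hbdd h
        · obtain ⟨m', hm', hlt⟩ := exists_lt_of_lt_csSup ⟨m₀, hm₀⟩ (lt_of_le_of_ne h.2 hm)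
          exact ⟨lt_of_lt_of_le hm'.1 (hW hlt.le), h.1, h.2.trans hcG⟩
      rw [setIntegral_congr_set hae, ← intervalIntegral.integral_of_le hc0]
      exact h c hc0 hcG
  rw [intervalIntegral.integral_of_le hG]
  simp_rw [hlayer]
  rw [integral_integral_swap hint]
  refine (integral_mono hint.integral_prod_right (integrable_const 1) hinner).trans ?_
  simp

/-! ### The value of the family of coins -/

namespace Setting

variable (θ : Setting)

/-- Whittle's product formula for the least expected number of further tosses, when the coins in
`S` are in the states `x` and all other coins are fresh. The fresh coins act as an option to quit at
the cost `freshIndex`. -/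
def jointValue (S : Finset ℕ) (x : ℕ → ℕ × ℕ) : ℝ :=
  ∫ m in (0 : ℝ)..θ.freshIndex, ∏ i ∈ S, θ.quitProb (x i) m

lemma antitone_prod_quitProb (S : Finset ℕ) (x : ℕ → ℕ × ℕ) :
    Antitone fun m => ∏ i ∈ S, θ.quitProb (x i) m := fun _ _ h =>
  Finset.prod_le_prod (fun _ _ => θ.quitProb_nonneg _ _) fun _ _ => θ.antitone_quitProb _ h

lemma prod_quitProb_nonneg (S : Finset ℕ) (x : ℕ → ℕ × ℕ) (m : ℝ) :
    0 ≤ ∏ i ∈ S, θ.quitProb (x i) m :=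
  Finset.prod_nonneg fun _ _ => θ.quitProb_nonneg _ _

lemma prod_quitProb_le_one (S : Finset ℕ) (x : ℕ → ℕ × ℕ) (m : ℝ) :
    ∏ i ∈ S, θ.quitProb (x i) m ≤ 1 :=
  Finset.prod_le_one (fun _ _ => θ.quitProb_nonneg _ _) fun _ _ => θ.quitProb_le_one _ _

lemma jointValue_nonneg (S : Finset ℕ) (x : ℕ → ℕ × ℕ) : 0 ≤ θ.jointValue S x :=
  intervalIntegral.integral_nonneg θ.freshIndex_nonneg fun _ _ => θ.prod_quitProb_nonneg _ _ _

lemma jointValue_le (S : Finset ℕ) (x : ℕ → ℕ × ℕ) : θ.jointValue S x ≤ θ.freshIndex := by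
  have h := intervalIntegral.integral_mono_on θ.freshIndex_nonneg
    (θ.antitone_prod_quitProb S x).intervalIntegrable
    (intervalIntegrable_const (μ := volume) (c := (1 : ℝ)))
    (fun m _ => θ.prod_quitProb_le_one S x m)
  simpa [jointValue] using h

lemma jointValue_of_target {S : Finset ℕ} {x : ℕ → ℕ × ℕ} {i : ℕ} (hi : i ∈ S)
    (h : 1 - θ.δ ≤ θ.post (x i)) : θ.jointValue S x = 0 := by
  have : ∀ m, ∏ i ∈ S, θ.quitProb (x i) m = 0 := fun m =>
    Finset.prod_eq_zero hi (θ.quitProb_of_target h m)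
  simp [jointValue, this]

/-- Fresh coins do not matter in the product formula. -/
lemma jointValue_congr {S T : Finset ℕ} (x : ℕ → ℕ × ℕ) (hST : S ⊆ T)
    (h : ∀ i ∈ T, i ∉ S → x i = (0, 0)) : θ.jointValue T x = θ.jointValue S x := by
  unfold jointValue
  rw [intervalIntegral.integral_of_le θ.freshIndex_nonneg,
    intervalIntegral.integral_of_le θ.freshIndex_nonneg, integral_Ioc_eq_integral_Ioo,
    integral_Ioc_eq_integral_Ioo]
  refine setIntegral_congr_fun measurableSet_Ioo fun m hm => ?_
  refine (Finset.prod_subset hST fun i hi hi' => ?_).symm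
  rw [h i hi hi', θ.quitProb_fresh hm.1.le hm.2]

/-- The drift of the joint value in one toss of coin `i`, as a weighted integral: the weight is
contributed by the other coins. -/
lemma jointValue_sub (S : Finset ℕ) (x : ℕ → ℕ × ℕ) {i : ℕ} (hi : i ∈ S) :
    θ.jointValue S x - θ.expNext (fun s => θ.jointValue S (Function.update x i s)) (x i) =
      ∫ m in (0 : ℝ)..θ.freshIndex, (∏ j ∈ S.erase i, θ.quitProb (x j) m) *
        (θ.quitProb (x i) m - θ.expNext (fun s => θ.quitProb s m) (x i)) := by
  have hint : ∀ y : ℕ → ℕ × ℕ, IntervalIntegrable (fun m => ∏ j ∈ S, θ.quitProb (y j) m) volume 0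
      θ.freshIndex := fun y => (θ.antitone_prod_quitProb S y).intervalIntegrable
  have hprod : ∀ s m, ∏ j ∈ S, θ.quitProb (Function.update x i s j) m =
      (∏ j ∈ S.erase i, θ.quitProb (x j) m) * θ.quitProb s m := by
    intro s m
    rw [← Finset.prod_erase_mul _ _ hi, Function.update_self]
    congr 1
    refine Finset.prod_congr rfl fun j hj => ?_
    rw [Function.update_of_ne (Finset.ne_of_mem_erase hj)]
  have hprod' : ∀ m, ∏ j ∈ S, θ.quitProb (x j) m =
      (∏ j ∈ S.erase i, θ.quitProb (x j) m) * θ.quitProb (x i) m := fun m =>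
    (Finset.prod_erase_mul _ _ hi).symm
  simp only [jointValue, expNext]
  rw [← intervalIntegral.integral_const_mul, ← intervalIntegral.integral_const_mul,
    ← intervalIntegral.integral_add ((hint _).const_mul _) ((hint _).const_mul _),
    ← intervalIntegral.integral_sub (hint x) (((hint _).const_mul _).add ((hint _).const_mul _))]
  refine intervalIntegral.integral_congr fun m _ => ?_
  simp only [hprod, hprod']
  ring

lemma intervalIntegrable_quitProb_sub (s : ℕ × ℕ) (g : ℝ) :
    IntervalIntegrable (fun m => θ.quitProb s m - θ.expNext (fun s => θ.quitProb s m) s)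
      volume 0 g :=
  (θ.antitone_quitProb s).intervalIntegrable.sub
    (((θ.antitone_quitProb _).intervalIntegrable.const_mul _).add
      ((θ.antitone_quitProb _).intervalIntegrable.const_mul _))

lemma integral_quitProb_sub (s : ℕ × ℕ) {g : ℝ} (hg : 0 ≤ g) :
    ∫ m in (0 : ℝ)..g, (θ.quitProb s m - θ.expNext (fun s => θ.quitProb s m) s) =
      θ.quitValue s g - θ.expNext (fun s => θ.quitValue s g) s := by
  have hint : ∀ t, IntervalIntegrable (fun m => θ.quitProb t m) volume 0 g := fun t =>
    (θ.antitone_quitProb t).intervalIntegrable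
  simp only [expNext]
  rw [intervalIntegral.integral_sub (hint s) (((hint _).const_mul _).add ((hint _).const_mul _)),
    intervalIntegral.integral_add ((hint _).const_mul _) ((hint _).const_mul _),
    intervalIntegral.integral_const_mul, intervalIntegral.integral_const_mul]
  simp only [θ.integral_quitProb _ hg]

/-- The Bellman inequality: no toss decreases the joint value by more than its cost on average. -/
lemma jointValue_le_one_add (S : Finset ℕ) (x : ℕ → ℕ × ℕ) {i : ℕ} (hi : i ∈ S) :
    θ.jointValue S x ≤
      1 + θ.expNext (fun s => θ.jointValue S (Function.update x i s)) (x i) := by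
  have h := integral_antitone_mul_le_one θ.freshIndex_nonneg
    (θ.antitone_prod_quitProb (S.erase i) x) (θ.prod_quitProb_nonneg _ _)
    (θ.prod_quitProb_le_one _ _) (θ.intervalIntegrable_quitProb_sub (x i) _) (fun g hg _ => by
      rw [θ.integral_quitProb_sub _ hg]
      linarith [θ.quitValue_le_one_add (x i) hg])
  rw [← θ.jointValue_sub S x hi] at h
  linarith

/-- The Bellman equality: tossing a coin that is most likely to be heavy decreases the joint value
by exactly `1` on average. -/
lemma jointValue_eq_one_add (S : Finset ℕ) (x : ℕ → ℕ × ℕ) {i : ℕ} (hi : i ∈ S)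
    (hx : ¬ 1 - θ.δ ≤ θ.post (x i)) (hfresh : θ.post (0, 0) ≤ θ.post (x i))
    (hmax : ∀ j ∈ S, θ.post (x j) ≤ θ.post (x i)) :
    θ.jointValue S x =
      1 + θ.expNext (fun s => θ.jointValue S (Function.update x i s)) (x i) := by
  have h := θ.jointValue_sub S x hi
  -- Where the increment of coin `i` does not vanish, coin `i` is quit for certain, and so are all
  -- others: the weight is `1`.
  have hW : Set.EqOn (fun m => (∏ j ∈ S.erase i, θ.quitProb (x j) m) *
        (θ.quitProb (x i) m - θ.expNext (fun s => θ.quitProb s m) (x i)))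
      (fun m => θ.quitProb (x i) m - θ.expNext (fun s => θ.quitProb s m) (x i))
      (Set.uIcc 0 θ.freshIndex) := by
    intro m hm
    rw [Set.uIcc_of_le θ.freshIndex_nonneg] at hm
    dsimp only
    by_cases hq : ∀ m', m < m' → θ.quitValue (x i) m' < m'
    · rw [θ.quitProb_eq_expNext hx hq, sub_self, mul_zero]
    · push Not at hq
      obtain ⟨m', hlt, hle⟩ := hq
      have hm' : 0 ≤ m' := hm.1.trans hlt.le
      have : ∏ j ∈ S.erase i, θ.quitProb (x j) m = 1 := by
        refine Finset.prod_eq_one fun j hj => θ.quitProb_eq_one hm.1 hlt ?_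
        exact le_antisymm (θ.quitValue_le _ hm')
          (hle.trans (θ.quitValue_antitone_post hm' (hmax j (Finset.mem_of_mem_erase hj))))
      rw [this, one_mul]
  rw [intervalIntegral.integral_congr hW, θ.integral_quitProb_sub _ θ.freshIndex_nonneg,
    θ.quitValue_freshIndex hx hfresh] at h
  linarith

end Setting

/-! ### Histories as states of the coins -/

namespace History

/-- The state of coin `i` after the history `h`. -/
def state (h : History) (i : ℕ) : ℕ × ℕ := (heads h i, tails h i)

/-- The set of the coins that have been tossed. -/
def coins (h : History) : Finset ℕ := (h.map Prod.fst).toFinset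

lemma coins_cons (i : ℕ) (b : Bool) (h : History) : coins ((i, b) :: h) = insert i (coins h) := by
  simp [coins]

lemma state_cons (i : ℕ) (b : Bool) (h : History) :
    state ((i, b) :: h) = Function.update (state h) i (record (state h i) b) := by
  funext j
  by_cases hj : j = i
  · subst hj
    rw [Function.update_self]
    cases b <;> simp [state, record, heads, tails]
  · rw [Function.update_of_ne hj]
    simp [state, heads, tails, Ne.symm hj]

lemma state_of_notMem {h : History} {i : ℕ} (hi : i ∉ coins h) : state h i = (0, 0) := by
  have : ∀ b, (i, b) ∉ h := fun b hb => hi (by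
    simpa [coins] using (⟨b, hb⟩ : ∃ b, (i, b) ∈ h))
  simp [state, heads, tails, List.count_eq_zero, this]

lemma tosses_cons_self (i : ℕ) (b : Bool) (h : History) :
    tosses ((i, b) :: h) i = tosses h i + 1 := by
  cases b <;> simp [tosses, heads, tails] <;> omega

lemma tosses_cons_of_ne {i j : ℕ} (hij : j ≠ i) (b : Bool) (h : History) :
    tosses ((i, b) :: h) j = tosses h j := by
  simp [tosses, heads, tails, hij.symm]

/-- The outcome of toss number `k` of coin `i` in the history `h`; a default value if there is no
such toss. -/
def outcome : History → ℕ → ℕ → Bool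
  | [] => fun _ _ => true
  | (i, b) :: h => Function.update (outcome h) i (Function.update (outcome h i) (tosses h i) b)

/-- The event that the tosses of coin `i` in the history have the outcomes listed there. -/
def coinEvent (h : History) (i : ℕ) : Set (ℕ → Bool) :=
  {y | ∀ k ∈ Finset.range (tosses h i), y k = outcome h i k}

lemma coinEvent_cons_self (i : ℕ) (b : Bool) (h : History) :
    coinEvent ((i, b) :: h) i = {y | y (tosses h i) = b} ∩ coinEvent h i := by
  ext y
  simp only [coinEvent, tosses_cons_self, Finset.range_add_one, Finset.forall_mem_insert, outcome,
    Function.update_self, Set.mem_ofPred_eq, Set.mem_inter_iff]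
  refine and_congr_right fun _ => forall₂_congr fun k hk => ?_
  rw [Function.update_of_ne (Finset.mem_range.1 hk).ne]

lemma coinEvent_cons_of_ne {i j : ℕ} (hij : j ≠ i) (b : Bool) (h : History) :
    coinEvent ((i, b) :: h) j = coinEvent h j := by
  ext y
  simp only [coinEvent, tosses_cons_of_ne hij, outcome, Function.update_of_ne hij]

lemma coinEvent_of_notMem {h : History} {i : ℕ} (hi : i ∉ coins h) :
    coinEvent h i = Set.univ := by
  have h1 := state_of_notMem hi
  have h2 : tosses h i = 0 := by
    simp only [state, Prod.mk.injEq] at h1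
    simp [tosses, h1]
  simp [coinEvent, h2]

lemma event_eq (h : History) : event h = {ω | ∀ i, (ω i).2 ∈ coinEvent h i} := by
  induction h with
  | nil => simp [event, coinEvent, tosses, heads, tails]
  | cons c h ih =>
    obtain ⟨i, b⟩ := c
    ext ω
    rw [event, ih]
    simp only [Set.mem_inter_iff, Set.mem_ofPred_eq]
    constructor
    · rintro ⟨h1, h2⟩ j
      by_cases hj : j = i
      · subst hj
        rw [coinEvent_cons_self]
        exact ⟨h1, h2 j⟩
      · rw [coinEvent_cons_of_ne hj]
        exact h2 j
    · intro h1
      have h2 := h1 i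
      rw [coinEvent_cons_self] at h2
      refine ⟨h2.1, fun j => ?_⟩
      by_cases hj : j = i
      · subst hj
        exact h2.2
      · have h3 := h1 j
        rwa [coinEvent_cons_of_ne hj] at h3

lemma measurableSet_coinEvent (h : History) (i : ℕ) : MeasurableSet (coinEvent h i) := by
  have : coinEvent h i = ⋂ k ∈ Finset.range (tosses h i), {y | y k = outcome h i k} := by
    ext y; simp [coinEvent]
  rw [this]
  exact Finset.measurableSet_biInter _ fun k _ =>
    (measurableSet_singleton (outcome h i k)).preimage (measurable_pi_apply k)

lemma measurableSet_event (h : History) : MeasurableSet (event h) := by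
  rw [event_eq, Set.ofPred_forall]
  exact MeasurableSet.iInter fun i =>
    (measurable_snd.comp (measurable_pi_apply i)) (measurableSet_coinEvent h i)

end History

namespace Setting

open History

variable (θ : Setting)

/-! ### The law of the coins given a history -/

lemma outcomesLaw_coinEvent (c : Bool) (h : History) (i : ℕ) :
    θ.outcomesLaw c (coinEvent h i) =
      ENNReal.ofReal ((θ.bias c : ℝ) ^ heads h i * (1 - (θ.bias c : ℝ)) ^ tails h i) := by
  have h1 : θ.outcomesLaw c (coinEvent h i) = ∏ k ∈ Finset.range (tosses h i),
      bernoulliMeasure true false (θ.bias c) {outcome h i k} := by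
    rw [outcomesLaw, ← Measure.infinitePi_pi _ fun _ _ => measurableSet_singleton _]
    rfl
  rw [h1]
  have hb0 : 0 ≤ (θ.bias c : ℝ) := (θ.bias c).2.1
  have hb1 : 0 ≤ 1 - (θ.bias c : ℝ) := sub_nonneg.2 (θ.bias c).2.2
  clear h1
  induction h with
  | nil => simp [tosses, heads, tails]
  | cons a h ih =>
    obtain ⟨j, b⟩ := a
    by_cases hij : i = j
    · subst hij
      rw [tosses_cons_self, Finset.prod_range_succ]
      have h2 : ∏ k ∈ Finset.range (tosses h i),
          bernoulliMeasure true false (θ.bias c) {outcome ((i, b) :: h) i k} =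
          ∏ k ∈ Finset.range (tosses h i),
            bernoulliMeasure true false (θ.bias c) {outcome h i k} := by
        refine Finset.prod_congr rfl fun k hk => ?_
        rw [outcome, Function.update_self, Function.update_of_ne (Finset.mem_range.1 hk).ne]
      rw [h2, ih, outcome, Function.update_self, Function.update_self]
      have h3 : bernoulliMeasure true false (θ.bias c) {b} =
          ENNReal.ofReal (if b then (θ.bias c : ℝ) else 1 - (θ.bias c : ℝ)) := by
        rw [← ofReal_measureReal, bernoulliMeasure_real_apply _ (measurableSet_singleton b)]
        cases b <;> simp
      rw [h3, ← ENNReal.ofReal_mul (by positivity)]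
      cases b
      · simp [heads, tails, pow_succ, mul_assoc]
      · simp only [heads, tails, List.count_cons, if_true]
        congr 1
        simp [pow_succ]
        ring
    · rw [tosses_cons_of_ne hij]
      simp only [outcome, Function.update_of_ne hij]
      rw [ih]
      simp [heads, tails, Ne.symm hij]

lemma coinLaw_heavy_inter_coinEvent (h : History) (i : ℕ) :
    θ.coinLaw {x | x.1 = true ∧ x.2 ∈ coinEvent h i} =
      ENNReal.ofReal (θ.heavyWeight (state h i)) := by
  have h1 : {x : Bool × (ℕ → Bool) | x.1 = true ∧ x.2 ∈ coinEvent h i} =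
      {true} ×ˢ coinEvent h i := rfl
  rw [h1, coinLaw, Measure.add_apply, Measure.smul_apply, Measure.smul_apply, Measure.prod_prod,
    Measure.prod_prod, outcomesLaw_coinEvent]
  simp only [measurableSet_singleton, Measure.dirac_apply', smul_eq_mul]
  simp only [Set.mem_singleton_iff, Set.indicator_of_mem, Pi.one_apply, one_mul, Bool.false_eq_true,
    not_false_eq_true, Set.indicator_of_notMem, zero_mul, mul_zero, add_zero]
  rw [← ENNReal.ofReal_mul θ.α_pos.le, heavyWeight, state, bias]
  congr 4
  ring

lemma coinLaw_coinEvent (h : History) (i : ℕ) :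
    θ.coinLaw {x | x.2 ∈ coinEvent h i} = ENNReal.ofReal (θ.weight (state h i)) := by
  have h1 : {x : Bool × (ℕ → Bool) | x.2 ∈ coinEvent h i} = Set.univ ×ˢ coinEvent h i := by
    ext x; simp
  have hα : 0 ≤ 1 - θ.α := by linarith [θ.α_lt]
  rw [h1, coinLaw, Measure.add_apply, Measure.smul_apply, Measure.smul_apply, Measure.prod_prod,
    Measure.prod_prod, outcomesLaw_coinEvent, outcomesLaw_coinEvent]
  simp only [measure_univ, one_mul, smul_eq_mul]
  rw [← ENNReal.ofReal_mul θ.α_pos.le, ← ENNReal.ofReal_mul hα, ← ENNReal.ofReal_add]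
  · rw [weight, heavyWeight, lightWeight, state, bias, bias]
    congr 5 <;> ring
  · exact mul_nonneg θ.α_pos.le (mul_nonneg (pow_nonneg (θ.bias true).2.1 _)
      (pow_nonneg (sub_nonneg.2 (θ.bias true).2.2) _))
  · exact mul_nonneg hα (mul_nonneg (pow_nonneg (θ.bias false).2.1 _)
      (pow_nonneg (sub_nonneg.2 (θ.bias false).2.2) _))

/-- Only finitely many coins are constrained, so the event of a history is a cylinder. -/
lemma event_eq_pi {h : History} {S : Finset ℕ} (hS : coins h ⊆ S) :
    event h = Set.pi S fun i => {x : Bool × (ℕ → Bool) | x.2 ∈ coinEvent h i} := by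
  rw [event_eq]
  ext ω
  simp only [Set.mem_ofPred_eq, Set.mem_pi, Finset.mem_coe]
  refine ⟨fun h1 i _ => h1 i, fun h1 i => ?_⟩
  by_cases hi : i ∈ S
  · exact h1 i hi
  · rw [coinEvent_of_notMem fun h2 => hi (hS h2)]
    trivial

lemma law_event {h : History} {S : Finset ℕ} (hS : coins h ⊆ S) :
    θ.law (event h) = ENNReal.ofReal (∏ i ∈ S, θ.weight (state h i)) := by
  have hm : ∀ j ∈ S, MeasurableSet {x : Bool × (ℕ → Bool) | x.2 ∈ coinEvent h j} := fun j _ =>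
    measurable_snd (measurableSet_coinEvent h j)
  rw [event_eq_pi hS, law, Measure.infinitePi_pi _ hm,
    ENNReal.ofReal_prod_of_nonneg fun i _ => (θ.weight_pos _).le]
  exact Finset.prod_congr rfl fun i _ => θ.coinLaw_coinEvent h i

lemma law_event_inter_heavy {h : History} {S : Finset ℕ} (hS : coins h ⊆ S) {i : ℕ} (hi : i ∈ S) :
    θ.law (event h ∩ {ω | (ω i).1 = true}) = ENNReal.ofReal (θ.heavyWeight (state h i) *
      ∏ j ∈ S.erase i, θ.weight (state h j)) := by
  have h1 : event h ∩ {ω | (ω i).1 = true} = Set.pi S fun j =>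
      if j = i then {x : Bool × (ℕ → Bool) | x.1 = true ∧ x.2 ∈ coinEvent h i}
      else {x | x.2 ∈ coinEvent h j} := by
    rw [event_eq_pi hS]
    ext ω
    simp only [Set.mem_inter_iff, Set.mem_pi, Finset.mem_coe, Set.mem_ofPred_eq]
    constructor
    · rintro ⟨h2, h3⟩ j hj
      split_ifs with hji
      · subst hji
        exact ⟨h3, h2 j hj⟩
      · exact h2 j hj
    · intro h2
      refine ⟨fun j hj => ?_, ?_⟩
      · have h3 := h2 j hj
        split_ifs at h3 with hji
        · subst hji
          exact h3.2
        · exact h3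
      · have h3 := h2 i hi
        rw [if_pos rfl] at h3
        exact h3.1
  have hm : ∀ j, MeasurableSet {x : Bool × (ℕ → Bool) | x.2 ∈ coinEvent h j} := fun j =>
    measurable_snd (measurableSet_coinEvent h j)
  rw [h1, law, Measure.infinitePi_pi, ← Finset.mul_prod_erase _ _ hi, if_pos rfl,
    coinLaw_heavy_inter_coinEvent, ENNReal.ofReal_mul (θ.heavyWeight_nonneg _),
    ENNReal.ofReal_prod_of_nonneg fun i _ => (θ.weight_pos _).le]
  · congr 1
    refine Finset.prod_congr rfl fun j hj => ?_
    rw [if_neg (Finset.ne_of_mem_erase hj), coinLaw_coinEvent]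
  · intro j _
    split_ifs
    · exact (measurable_fst (measurableSet_singleton true)).inter (hm i)
    · exact hm j

lemma law_event_ne_zero (h : History) : θ.law (event h) ≠ 0 := by
  rw [θ.law_event subset_rfl, ENNReal.ofReal_ne_zero_iff]
  exact Finset.prod_pos fun i _ => θ.weight_pos _

instance isProbabilityMeasure_given (h : History) : IsProbabilityMeasure (θ.given h) :=
  cond_isProbabilityMeasure (θ.law_event_ne_zero h)

lemma posterior_eq (h : History) (i : ℕ) : θ.posterior h i = θ.post (state h i) := by
  have hS : coins h ⊆ insert i (coins h) := Finset.subset_insert _ _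
  have hi : i ∈ insert i (coins h) := Finset.mem_insert_self _ _
  rw [posterior, given, measureReal_def, cond_apply (measurableSet_event h),
    θ.law_event_inter_heavy hS hi, θ.law_event hS, ← Finset.mul_prod_erase _ _ hi,
    ENNReal.toReal_mul,
    ENNReal.toReal_inv, ENNReal.toReal_ofReal, ENNReal.toReal_ofReal, post]
  · have h1 := (θ.weight_pos (state h i)).ne'
    have h2 : ∏ j ∈ (insert i (coins h)).erase i, θ.weight (state h j) ≠ 0 :=
      Finset.prod_ne_zero_iff.2 fun j _ => (θ.weight_pos _).ne'
    field_simp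
  · exact mul_nonneg (θ.heavyWeight_nonneg _) (Finset.prod_nonneg fun j _ => (θ.weight_pos _).le)
  · exact mul_nonneg (θ.weight_pos _).le (Finset.prod_nonneg fun j _ => (θ.weight_pos _).le)

lemma law_event_cons (i : ℕ) (b : Bool) (h : History) :
    θ.law (event ((i, b) :: h)) =
      ENNReal.ofReal (θ.pred (state h i) b) * θ.law (event h) := by
  have hS : coins h ⊆ insert i (coins h) := Finset.subset_insert _ _
  have hi : i ∈ insert i (coins h) := Finset.mem_insert_self _ _
  rw [θ.law_event hS, θ.law_event (coins_cons i b h).subset,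
    ← ENNReal.ofReal_mul (θ.pred_pos _ _).le, ← Finset.mul_prod_erase _ _ hi,
    ← Finset.mul_prod_erase _ _ hi, state_cons, Function.update_self, ← mul_assoc, pred,
    div_mul_cancel₀ _ (θ.weight_pos _).ne']
  congr 2
  refine Finset.prod_congr rfl fun j hj => ?_
  rw [Function.update_of_ne (Finset.ne_of_mem_erase hj)]

/-- The law given a history is the average, over the outcome of the next toss of any coin, of the
laws given the prolonged histories. -/
lemma given_eq_add (h : History) (i : ℕ) :
    θ.given h = ENNReal.ofReal (θ.pred (state h i) true) • θ.given ((i, true) :: h) +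
      ENNReal.ofReal (θ.pred (state h i) false) • θ.given ((i, false) :: h) := by
  have hb : ∀ b, ENNReal.ofReal (θ.pred (state h i) b) • θ.given ((i, b) :: h) =
      (θ.law (event h))⁻¹ • θ.law.restrict (event ((i, b) :: h)) := by
    intro b
    have hp : ENNReal.ofReal (θ.pred (state h i) b) ≠ 0 :=
      ENNReal.ofReal_ne_zero_iff.2 (θ.pred_pos _ _)
    rw [given, ProbabilityTheory.cond, smul_smul, law_event_cons, ENNReal.mul_inv (Or.inl hp)
      (Or.inl ENNReal.ofReal_ne_top), ← mul_assoc, ENNReal.mul_inv_cancel hp ENNReal.ofReal_ne_top,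
      one_mul]
  have hunion : event h = event ((i, true) :: h) ∪ event ((i, false) :: h) := by
    ext ω
    simp only [event, Set.mem_union, Set.mem_inter_iff, Set.mem_ofPred_eq]
    cases (ω i).2 (tosses h i) <;> simp
  have hdisj : Disjoint (event ((i, true) :: h)) (event ((i, false) :: h)) := by
    rw [Set.disjoint_left]
    rintro ω ⟨h1, -⟩ ⟨h2, -⟩
    simp only [Set.mem_ofPred_eq] at h1 h2
    simp [h1] at h2
  rw [hb, hb, ← smul_add, ← Measure.restrict_union hdisj (measurableSet_event _), ← hunion]
  rfl

lemma ae_mem_event (h : History) : ∀ᵐ ω ∂θ.given h, ω ∈ event h :=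
  ae_cond_mem (measurableSet_event h)

/-! ### Likelihood ratios -/

lemma likelihoodRatio_eq (h : History) (i : ℕ) :
    θ.likelihoodRatio h i =
      ENNReal.ofReal ((θ.p + θ.ε) ^ heads h i * (1 - θ.p - θ.ε) ^ tails h i) /
        ENNReal.ofReal ((θ.p - θ.ε) ^ heads h i * (1 - θ.p + θ.ε) ^ tails h i) := by
  have h1 : 0 ≤ θ.p + θ.ε := by linarith [θ.ε_pos, θ.ε_le_p]
  have h2 : 0 ≤ θ.p - θ.ε := by linarith [θ.ε_le_p]
  have h3 : 0 ≤ 1 - θ.p - θ.ε := by linarith [θ.p_le]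
  have h4 : 0 ≤ 1 - θ.p + θ.ε := by linarith [θ.p_le, θ.ε_pos]
  rw [likelihoodRatio, ENNReal.ofReal_mul (pow_nonneg h1 _), ENNReal.ofReal_mul (pow_nonneg h2 _),
    ENNReal.ofReal_pow h1, ENNReal.ofReal_pow h2, ENNReal.ofReal_pow h3, ENNReal.ofReal_pow h4]
  simp only [div_eq_mul_inv, mul_pow]
  rw [ENNReal.mul_inv (Or.inr (ENNReal.pow_ne_top ENNReal.ofReal_ne_top))
    (Or.inl (ENNReal.pow_ne_top ENNReal.ofReal_ne_top)), ENNReal.inv_pow, ENNReal.inv_pow]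
  ring

lemma _root_.ENNReal.ofReal_div_le_ofReal_div_iff {a b c d : ℝ} (hb : 0 ≤ b)
    (hc : 0 ≤ c) (hd : 0 ≤ d) (hab : 0 < a + b) (hcd : 0 < c + d) :
    ENNReal.ofReal a / ENNReal.ofReal b ≤ ENNReal.ofReal c / ENNReal.ofReal d ↔
      a * d ≤ c * b := by
  rcases hd.eq_or_lt with rfl | hd
  · have hc' : 0 < c := by linarith
    rw [ENNReal.ofReal_zero, ENNReal.div_zero (ENNReal.ofReal_ne_zero_iff.2 hc')]
    simp [mul_nonneg hc hb]
  rcases hb.eq_or_lt with rfl | hb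
  · have ha' : 0 < a := by linarith
    rw [ENNReal.ofReal_zero, ENNReal.div_zero (ENNReal.ofReal_ne_zero_iff.2 ha'),
      ← ENNReal.ofReal_div_of_pos hd]
    simp [mul_pos ha' hd]
  rw [← ENNReal.ofReal_div_of_pos hd, ← ENNReal.ofReal_div_of_pos hb,
    ENNReal.ofReal_le_ofReal_iff (div_nonneg hc hd.le), div_le_div_iff₀ hb hd]

lemma likelihoodRatio_eq_weights (h : History) (i : ℕ) :
    θ.likelihoodRatio h i = ENNReal.ofReal (θ.heavyWeight (state h i) / θ.α) /
      ENNReal.ofReal (θ.lightWeight (state h i) / (1 - θ.α)) := by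
  have h1 : 1 - θ.α ≠ 0 := by linarith [θ.α_lt]
  rw [likelihoodRatio_eq, heavyWeight, lightWeight, mul_div_cancel_left₀ _ θ.α_pos.ne',
    mul_div_cancel_left₀ _ h1]
  rfl

lemma likelihoodRatio_le_iff (h h' : History) (i j : ℕ) :
    θ.likelihoodRatio h i ≤ θ.likelihoodRatio h' j ↔
      θ.post (state h i) ≤ θ.post (state h' j) := by
  have hα := θ.α_pos
  have hα' : 0 < 1 - θ.α := by linarith [θ.α_lt]
  have hpos : ∀ s, 0 < θ.heavyWeight s / θ.α + θ.lightWeight s / (1 - θ.α) := by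
    intro s
    have hw : 0 < θ.heavyWeight s + θ.lightWeight s := θ.weight_pos s
    rcases (θ.heavyWeight_nonneg s).eq_or_lt with h1 | h1
    · have h2 : 0 < θ.lightWeight s := by linarith
      rw [← h1, zero_div, zero_add]
      exact div_pos h2 hα'
    · exact add_pos_of_pos_of_nonneg (div_pos h1 hα)
        (div_nonneg (θ.lightWeight_nonneg s) hα'.le)
  rw [likelihoodRatio_eq_weights, likelihoodRatio_eq_weights,
    ENNReal.ofReal_div_le_ofReal_div_iff (div_nonneg (θ.lightWeight_nonneg _) hα'.le)
      (div_nonneg (θ.heavyWeight_nonneg _) hα.le)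
      (div_nonneg (θ.lightWeight_nonneg _) hα'.le) (hpos _) (hpos _), post_le_post_iff,
    div_mul_div_comm, div_mul_div_comm, div_le_div_iff_of_pos_right (mul_pos hα hα')]

lemma threshold_le_iff (h : History) (i : ℕ) :
    θ.threshold ≤ θ.likelihoodRatio h i ↔ 1 - θ.δ ≤ θ.post (state h i) := by
  have hα := θ.α_pos
  have hα' : 0 < 1 - θ.α := by linarith [θ.α_lt]
  have hδ := θ.δ_pos
  set A := θ.heavyWeight (state h i) with hA
  set B := θ.lightWeight (state h i) with hB
  have hA0 : 0 ≤ A := θ.heavyWeight_nonneg _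
  have hB0 : 0 ≤ B := θ.lightWeight_nonneg _
  have hw : 0 < A + B := θ.weight_pos (state h i)
  have hpost : 1 - θ.δ ≤ θ.post (state h i) ↔ B * (1 - θ.δ) ≤ A * θ.δ := by
    rw [post, weight, ← hA, ← hB, le_div_iff₀ hw]
    constructor <;> intro h <;> linarith
  rw [hpost, threshold, likelihoodRatio_eq_weights, ← hA, ← hB]
  rcases hB0.eq_or_lt with h0 | h0
  · have h1 : 0 < A := by linarith
    rw [← h0, zero_div, ENNReal.ofReal_zero,
      ENNReal.div_zero (ENNReal.ofReal_ne_zero_iff.2 (div_pos h1 hα))]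
    simp only [le_top, zero_mul, true_iff]
    positivity
  · rw [← ENNReal.ofReal_div_of_pos (div_pos h0 hα'),
      ENNReal.ofReal_le_ofReal_iff (by positivity), div_le_div_iff₀ (by positivity) (by positivity)]
    have e1 : (1 - θ.α) * (1 - θ.δ) * (B / (1 - θ.α)) = B * (1 - θ.δ) := by
      field_simp
    have e2 : A / θ.α * (θ.α * θ.δ) = A * θ.δ := by field_simp
    rw [e1, e2]

end Setting

/-! ### Running a strategy -/

namespace Strategy

lemma run_of_output {σ : Strategy} {h : History} {i : ℕ} (hσ : σ h = .output i) (ω : World)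
    (n : ℕ) : run σ ω h n = h := by
  have h1 : step σ ω h = h := by simp [step, hσ]
  exact Function.iterate_fixed h1 n

lemma run_succ_of_toss {σ : Strategy} {h : History} {i : ℕ} (hσ : σ h = .toss i) (ω : World)
    (n : ℕ) : run σ ω h (n + 1) =
      run σ ω ((i, (ω i).2 (History.tosses h i)) :: h) n := by
  rw [run, Function.iterate_succ_apply]
  simp [step, hσ, run]

lemma measurable_run {X : Type*} [MeasurableSpace X] (σ : Strategy) (g : History → X)
    (h : History) (n : ℕ) : Measurable fun ω => g (run σ ω h n) := by
  induction n generalizing h with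
  | zero => exact measurable_const (a := g h)
  | succ n ih =>
    rcases hσ : σ h with i | i
    · simp only [run_succ_of_toss hσ]
      have h1 : (fun ω : World => g (run σ ω ((i, (ω i).2 (History.tosses h i)) :: h) n)) =
          fun ω => if (ω i).2 (History.tosses h i) = true then g (run σ ω ((i, true) :: h) n)
            else g (run σ ω ((i, false) :: h) n) := by
        funext ω
        cases (ω i).2 (History.tosses h i) <;> simp
      rw [h1]
      have h2 : Measurable fun ω : World => (ω i).2 (History.tosses h i) :=
        (measurable_pi_apply _).comp (measurable_snd.comp (measurable_pi_apply i))
      exact Measurable.ite (h2 (measurableSet_singleton true)) (ih _) (ih _)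
    · simp only [run_of_output hσ]
      exact measurable_const

end Strategy

namespace Setting

open History Strategy

variable (θ : Setting)

/-- The first step of a run that starts with a toss. -/
lemma lintegral_run_succ {σ : Strategy} {h : History} {i : ℕ} (hσ : σ h = .toss i)
    (G : History → World → ℝ≥0∞) (n : ℕ) :
    ∫⁻ ω, G (run σ ω h (n + 1)) ω ∂θ.given h =
      ENNReal.ofReal (θ.pred (state h i) true) *
          ∫⁻ ω, G (run σ ω ((i, true) :: h) n) ω ∂θ.given ((i, true) :: h) +
        ENNReal.ofReal (θ.pred (state h i) false) *
          ∫⁻ ω, G (run σ ω ((i, false) :: h) n) ω ∂θ.given ((i, false) :: h) := by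
  have hb : ∀ b, ∫⁻ ω, G (run σ ω h (n + 1)) ω ∂θ.given ((i, b) :: h) =
      ∫⁻ ω, G (run σ ω ((i, b) :: h) n) ω ∂θ.given ((i, b) :: h) := by
    intro b
    refine lintegral_congr_ae ((θ.ae_mem_event _).mono fun ω hω => ?_)
    have h1 : (ω i).2 (tosses h i) = b := hω.1
    simp only [run_succ_of_toss hσ, h1]
  conv_lhs => rw [θ.given_eq_add h i]
  rw [lintegral_add_measure, lintegral_smul_measure, lintegral_smul_measure, hb, hb]
  rfl

/-- The probability, given the history `h`, that the strategy taking over at `h` makes a toss in its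
step number `n`. -/
def tossProb (σ : Strategy) (h : History) (n : ℕ) : ℝ≥0∞ :=
  ∫⁻ ω, tossIndicator σ (run σ ω h n) ∂θ.given h

/-- The probability, given the history `h`, that the strategy taking over at `h` has output a heavy
coin after `n` steps. -/
def successProbBy (σ : Strategy) (h : History) (n : ℕ) : ℝ≥0∞ :=
  θ.given h {ω | ∃ i, σ (run σ ω h n) = .output i ∧ (ω i).1 = true}

lemma cost_eq_tsum (σ : Strategy) (h : History) : θ.cost σ h = ∑' n, θ.tossProb σ h n := by
  unfold cost furtherTosses tossProb
  exact lintegral_tsum fun n => (measurable_run σ (tossIndicator σ) h n).aemeasurable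

lemma tossProb_of_output {σ : Strategy} {h : History} {i : ℕ} (hσ : σ h = .output i) (n : ℕ) :
    θ.tossProb σ h n = 0 := by
  simp [tossProb, run_of_output hσ, tossIndicator, hσ]

lemma tossProb_zero_of_toss {σ : Strategy} {h : History} {i : ℕ} (hσ : σ h = .toss i) :
    θ.tossProb σ h 0 = 1 := by
  simp [tossProb, run, tossIndicator, hσ]

lemma tossProb_succ {σ : Strategy} {h : History} {i : ℕ} (hσ : σ h = .toss i) (n : ℕ) :
    θ.tossProb σ h (n + 1) =
      ENNReal.ofReal (θ.pred (state h i) true) * θ.tossProb σ ((i, true) :: h) n +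
        ENNReal.ofReal (θ.pred (state h i) false) * θ.tossProb σ ((i, false) :: h) n :=
  θ.lintegral_run_succ hσ (fun h _ => tossIndicator σ h) n

lemma sum_tossProb_succ {σ : Strategy} {h : History} {i : ℕ} (hσ : σ h = .toss i) (n : ℕ) :
    ∑ k ∈ Finset.range (n + 1), θ.tossProb σ h k = 1 +
      (ENNReal.ofReal (θ.pred (state h i) true) *
          ∑ k ∈ Finset.range n, θ.tossProb σ ((i, true) :: h) k +
        ENNReal.ofReal (θ.pred (state h i) false) *
          ∑ k ∈ Finset.range n, θ.tossProb σ ((i, false) :: h) k) := by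
  rw [Finset.sum_range_succ', tossProb_zero_of_toss θ hσ, add_comm, Finset.mul_sum, Finset.mul_sum,
    ← Finset.sum_add_distrib]
  simp only [tossProb_succ θ hσ]

lemma measurableSet_success (σ : Strategy) (h : History) (n : ℕ) :
    MeasurableSet {ω : World | ∃ i, σ (run σ ω h n) = .output i ∧ (ω i).1 = true} := by
  rw [Set.ofPred_exists]
  refine MeasurableSet.iUnion fun i => MeasurableSet.inter ?_ ?_
  · have h1 := measurable_run σ (fun h => σ h = .output i) h n
    exact measurableSet_setOfPred.2 h1
  · exact (measurable_fst.comp (measurable_pi_apply i)) (measurableSet_singleton true)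

lemma successProbBy_succ {σ : Strategy} {h : History} {i : ℕ} (hσ : σ h = .toss i) (n : ℕ) :
    θ.successProbBy σ h (n + 1) =
      ENNReal.ofReal (θ.pred (state h i) true) * θ.successProbBy σ ((i, true) :: h) n +
        ENNReal.ofReal (θ.pred (state h i) false) * θ.successProbBy σ ((i, false) :: h) n := by
  classical
  let G : History → World → ℝ≥0∞ := fun h' ω =>
    if ∃ i, σ h' = .output i ∧ (ω i).1 = true then 1 else 0
  have h1 : ∀ (h : History) (n : ℕ), θ.successProbBy σ h n =
      ∫⁻ ω, G (run σ ω h n) ω ∂θ.given h := by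
    intro h n
    rw [successProbBy, ← lintegral_indicator_one (measurableSet_success σ h n)]
    refine lintegral_congr fun ω => ?_
    simp [Set.indicator_apply, G]
  rw [h1, h1, h1]
  exact θ.lintegral_run_succ hσ G n

/-! ### Lower and upper bounds for the cost -/

/-- The joint value of the states of all coins after a history. -/
def value (h : History) : ℝ := θ.jointValue (coins h) (state h)

lemma value_nonneg (h : History) : 0 ≤ θ.value h := θ.jointValue_nonneg _ _

lemma value_le (h : History) : θ.value h ≤ θ.freshIndex := θ.jointValue_le _ _

lemma value_eq_insert (h : History) (i : ℕ) :
    θ.value h = θ.jointValue (insert i (coins h)) (state h) :=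
  (θ.jointValue_congr _ (Finset.subset_insert _ _) fun _ _ hj => state_of_notMem hj).symm

lemma value_cons (h : History) (i : ℕ) (b : Bool) :
    θ.value ((i, b) :: h) = θ.jointValue (insert i (coins h))
      (Function.update (state h) i (record (state h i) b)) := by
  rw [value, coins_cons, state_cons]

lemma value_of_target {h : History} {i : ℕ} (hi : 1 - θ.δ ≤ θ.post (state h i)) :
    θ.value h = 0 := by
  rw [θ.value_eq_insert h i]
  exact θ.jointValue_of_target (Finset.mem_insert_self _ _) hi

lemma value_le_one_add (h : History) (i : ℕ) :
    θ.value h ≤ 1 + (θ.pred (state h i) true * θ.value ((i, true) :: h) +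
      θ.pred (state h i) false * θ.value ((i, false) :: h)) := by
  rw [θ.value_eq_insert h i, value_cons, value_cons]
  exact θ.jointValue_le_one_add _ _ (Finset.mem_insert_self _ _)

lemma exists_state_eq_zero (h : History) : ∃ j, state h j = (0, 0) := by
  obtain ⟨j, hj⟩ := Infinite.exists_notMem_finset (coins h)
  exact ⟨j, state_of_notMem hj⟩

lemma value_eq_one_add {h : History} {i : ℕ} (hi : ¬ 1 - θ.δ ≤ θ.post (state h i))
    (hmax : ∀ j, θ.post (state h j) ≤ θ.post (state h i)) :
    θ.value h = 1 + (θ.pred (state h i) true * θ.value ((i, true) :: h) +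
      θ.pred (state h i) false * θ.value ((i, false) :: h)) := by
  obtain ⟨j, hj⟩ := exists_state_eq_zero h
  rw [θ.value_eq_insert h i, value_cons, value_cons]
  exact θ.jointValue_eq_one_add _ _ (Finset.mem_insert_self _ _) hi (hj ▸ hmax j)
    fun j _ => hmax j

lemma ofReal_one_add_expected (s : ℕ × ℕ) {x y : ℝ} (hx : 0 ≤ x) (hy : 0 ≤ y) :
    ENNReal.ofReal (1 + (θ.pred s true * x + θ.pred s false * y)) =
      1 + (ENNReal.ofReal (θ.pred s true) * ENNReal.ofReal x +
        ENNReal.ofReal (θ.pred s false) * ENNReal.ofReal y) := by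
  have h1 := mul_nonneg (θ.pred_pos s true).le hx
  have h2 := mul_nonneg (θ.pred_pos s false).le hy
  rw [ENNReal.ofReal_add zero_le_one (add_nonneg h1 h2), ENNReal.ofReal_add h1 h2,
    ENNReal.ofReal_mul (θ.pred_pos _ _).le, ENNReal.ofReal_mul (θ.pred_pos _ _).le,
    ENNReal.ofReal_one]

lemma ofReal_pred_add (s : ℕ × ℕ) :
    ENNReal.ofReal (θ.pred s true) + ENNReal.ofReal (θ.pred s false) = 1 := by
  rw [← ENNReal.ofReal_add (θ.pred_pos _ _).le (θ.pred_pos _ _).le, pred_true_add_pred_false,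
    ENNReal.ofReal_one]

/-- The truncated lower bound: an admissible strategy that has not stopped after `n` steps has saved
at most `freshIndex`, the largest possible value. -/
lemma value_le_sum_tossProb {σ : Strategy} (hσ : θ.Admissible σ) (n : ℕ) (h : History) :
    ENNReal.ofReal (θ.value h) ≤ ∑ k ∈ Finset.range n, θ.tossProb σ h k +
      ENNReal.ofReal θ.freshIndex * θ.tossProb σ h n := by
  induction n generalizing h with
  | zero =>
    rcases hh : σ h with i | i
    · simpa [tossProb_zero_of_toss θ hh] using ENNReal.ofReal_le_ofReal (θ.value_le h)
    · have := hσ h i hh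
      rw [posterior_eq] at this
      simp [θ.value_of_target this]
  | succ n ih =>
    rcases hh : σ h with i | i
    · refine (ENNReal.ofReal_le_ofReal (θ.value_le_one_add h i)).trans ?_
      rw [θ.ofReal_one_add_expected _ (θ.value_nonneg _) (θ.value_nonneg _),
        θ.sum_tossProb_succ hh, θ.tossProb_succ hh, add_assoc]
      refine add_le_add_right ?_ 1
      refine (add_le_add (mul_le_mul_right (ih _) _) (mul_le_mul_right (ih _) _)).trans
        (le_of_eq ?_)
      ring
    · have := hσ h i hh
      rw [posterior_eq] at this
      simp [θ.value_of_target this]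

lemma tendsto_tossProb {σ : Strategy} {h : History} (hc : θ.cost σ h ≠ ∞) :
    Filter.Tendsto (θ.tossProb σ h) Filter.atTop (nhds 0) := by
  rw [cost_eq_tsum] at hc
  have := ENNReal.tendsto_cofinite_zero_of_tsum_ne_top hc
  rwa [Nat.cofinite_eq_atTop] at this

/-- The joint value is a lower bound for the cost of every admissible strategy. -/
lemma value_le_cost {σ : Strategy} (hσ : θ.Admissible σ) (h : History) :
    ENNReal.ofReal (θ.value h) ≤ θ.cost σ h := by
  by_cases hc : θ.cost σ h = ∞
  · rw [hc]; exact le_top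
  have h1 : Filter.Tendsto (fun n => ∑ k ∈ Finset.range n, θ.tossProb σ h k +
      ENNReal.ofReal θ.freshIndex * θ.tossProb σ h n) Filter.atTop
      (nhds (θ.cost σ h + ENNReal.ofReal θ.freshIndex * 0)) := by
    refine Filter.Tendsto.add ?_
      (ENNReal.Tendsto.const_mul (θ.tendsto_tossProb hc) (Or.inr ENNReal.ofReal_ne_top))
    rw [cost_eq_tsum]
    exact ENNReal.tendsto_nat_tsum _
  rw [mul_zero, add_zero] at h1
  exact ge_of_tendsto' h1 fun n => θ.value_le_sum_tossProb hσ n h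

lemma IsLikelihoodToss.of_toss {θ : Setting} {σ : Strategy} (hσ : θ.IsLikelihoodToss σ)
    {h : History} {i : ℕ} (hi : σ h = .toss i) :
    ¬ 1 - θ.δ ≤ θ.post (state h i) ∧ ∀ j, θ.post (state h j) ≤ θ.post (state h i) := by
  by_cases hall : ∀ i, θ.likelihoodRatio h i < θ.threshold
  · obtain ⟨k, hk, hk'⟩ := (hσ h).1 hall
    obtain rfl : k = i := by simpa [hi] using hk'.symm
    refine ⟨fun hc => absurd ((θ.threshold_le_iff h k).2 hc) (not_le.2 (hall k)), fun j => ?_⟩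
    exact (θ.likelihoodRatio_le_iff h h j k).1 (hk j)
  · push Not at hall
    obtain ⟨k, -, hk'⟩ := (hσ h).2 hall
    simp [hi] at hk'

lemma IsLikelihoodToss.of_output {θ : Setting} {σ : Strategy} (hσ : θ.IsLikelihoodToss σ)
    {h : History} {i : ℕ} (hi : σ h = .output i) : 1 - θ.δ ≤ θ.post (state h i) := by
  by_cases hall : ∀ i, θ.likelihoodRatio h i < θ.threshold
  · obtain ⟨k, -, hk'⟩ := (hσ h).1 hall
    simp [hi] at hk'
  · push Not at hall
    obtain ⟨k, hk, hk'⟩ := (hσ h).2 hall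
    obtain rfl : k = i := by simpa [hi] using hk'.symm
    obtain ⟨j, hj⟩ := hall
    exact (θ.threshold_le_iff h k).1 (hj.trans (hk j))

lemma IsLikelihoodToss.admissible {θ : Setting} {σ : Strategy} (hσ : θ.IsLikelihoodToss σ) :
    θ.Admissible σ := fun h i hi => by
  rw [posterior_eq]
  exact hσ.of_output hi

lemma IsLikelihoodToss.sum_tossProb_le {θ : Setting} {σ : Strategy} (hσ : θ.IsLikelihoodToss σ)
    (n : ℕ) (h : History) :
    ∑ k ∈ Finset.range n, θ.tossProb σ h k ≤ ENNReal.ofReal (θ.value h) := by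
  induction n generalizing h with
  | zero => simp
  | succ n ih =>
    rcases hh : σ h with i | i
    · obtain ⟨h1, h2⟩ := hσ.of_toss hh
      rw [θ.value_eq_one_add h1 h2,
        θ.ofReal_one_add_expected _ (θ.value_nonneg _) (θ.value_nonneg _), θ.sum_tossProb_succ hh]
      exact add_le_add_right
        (add_le_add (mul_le_mul_right (ih _) _) (mul_le_mul_right (ih _) _)) 1
    · simp [θ.tossProb_of_output hh]

/-- Likelihood-Toss attains the joint value. -/
lemma IsLikelihoodToss.cost_le {θ : Setting} {σ : Strategy} (hσ : θ.IsLikelihoodToss σ)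
    (h : History) : θ.cost σ h ≤ ENNReal.ofReal (θ.value h) := by
  rw [cost_eq_tsum]
  exact le_of_tendsto' (ENNReal.tendsto_nat_tsum _) fun n => hσ.sum_tossProb_le n h

lemma IsLikelihoodToss.isOptimal {θ : Setting} {σ : Strategy} (hσ : θ.IsLikelihoodToss σ) :
    θ.IsOptimal σ := by
  refine ⟨hσ.admissible, fun h => ⟨(hσ.cost_le h).trans_lt ENNReal.ofReal_lt_top, ?_⟩⟩
  intro S _ ν _ τ hτ
  calc θ.cost σ h ≤ ∫⁻ _, θ.cost σ h ∂ν := by simp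
    _ ≤ ∫⁻ s, θ.cost (τ s) h ∂ν :=
      lintegral_mono fun s => (hσ.cost_le h).trans (θ.value_le_cost (hτ s) h)

/-! ### The probability of success -/

/-- After `n` steps, an admissible strategy either still tosses or has, with conditional probability
at least `1 - δ`, output a heavy coin. -/
lemma le_successProbBy {σ : Strategy} (hσ : θ.Admissible σ) (n : ℕ) (h : History) :
    ENNReal.ofReal (1 - θ.δ) ≤ θ.successProbBy σ h n + θ.tossProb σ h n := by
  have hδ : ENNReal.ofReal (1 - θ.δ) ≤ 1 := by
    rw [← ENNReal.ofReal_one]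
    exact ENNReal.ofReal_le_ofReal (by linarith [θ.δ_pos])
  have hout : ∀ (n : ℕ) (h : History) (i : ℕ), σ h = .output i →
      ENNReal.ofReal (1 - θ.δ) ≤ θ.successProbBy σ h n := by
    intro n h i hh
    have h1 : θ.successProbBy σ h n = θ.given h {ω | (ω i).1 = true} := by
      simp [successProbBy, run_of_output hh, hh]
    rw [h1, ← ofReal_measureReal]
    exact ENNReal.ofReal_le_ofReal (hσ h i hh)
  induction n generalizing h with
  | zero =>
    rcases hh : σ h with i | i
    · rw [θ.tossProb_zero_of_toss hh]
      exact hδ.trans le_add_self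
    · exact (hout 0 h i hh).trans le_self_add
  | succ n ih =>
    rcases hh : σ h with i | i
    · rw [θ.successProbBy_succ hh, θ.tossProb_succ hh]
      calc ENNReal.ofReal (1 - θ.δ)
          = ENNReal.ofReal (θ.pred (state h i) true) * ENNReal.ofReal (1 - θ.δ) +
            ENNReal.ofReal (θ.pred (state h i) false) * ENNReal.ofReal (1 - θ.δ) := by
            rw [← add_mul, ofReal_pred_add, one_mul]
        _ ≤ _ := add_le_add (mul_le_mul_right (ih ((i, true) :: h)) _)
            (mul_le_mul_right (ih ((i, false) :: h)) _)
        _ = _ := by ring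
    · exact (hout _ h i hh).trans le_self_add

lemma IsLikelihoodToss.le_successProb {θ : Setting} {σ : Strategy} (hσ : θ.IsLikelihoodToss σ)
    (h : History) : 1 - θ.δ ≤ θ.successProb σ h := by
  set p := θ.given h {ω | ∃ n i, σ (run σ ω h n) = .output i ∧ (ω i).1 = true} with hp
  have h1 : ∀ n, ENNReal.ofReal (1 - θ.δ) ≤ p + θ.tossProb σ h n := fun n =>
    (θ.le_successProbBy hσ.admissible n h).trans
      (add_le_add_left (measure_mono (Set.ofPred_subset_ofPred.2 fun ω hω => ⟨n, hω⟩)) _)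
  have hc : θ.cost σ h ≠ ∞ := ((hσ.cost_le h).trans_lt ENNReal.ofReal_lt_top).ne
  have h2 := ge_of_tendsto' ((θ.tendsto_tossProb hc).const_add p) h1
  rw [add_zero] at h2
  exact (ENNReal.ofReal_le_iff_le_toReal (measure_ne_top _ _)).1 h2

end Setting

/-! ### Programs with time bounds -/

/-- The program that performs a list of instructions. -/
def block : List Instr → Cmd
  | [] => .skip
  | c :: l => .seq (.instr c) (block l)

/-- Started in the state `s`, the program `c` halts in the state `s'` within time `T`. -/
def Runs (c : Cmd) (s : Store) (T : ℕ) (s' : Store) : Prop := ∃ t ≤ T, Exec c s t s'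

namespace Runs

variable {c c₁ c₂ : Cmd} {s s' s'' : Store} {T T' : ℕ} {b : Test}

lemma skip (s : Store) : Runs .skip s 0 s := ⟨0, le_rfl, .skip s⟩

lemma seq (h₁ : Runs c₁ s T s') (h₂ : Runs c₂ s' T' s'') : Runs (.seq c₁ c₂) s (T + T') s'' := by
  obtain ⟨t, ht, h⟩ := h₁
  obtain ⟨t', ht', h'⟩ := h₂
  exact ⟨t + t', add_le_add ht ht', .seq h h'⟩

lemma ite_true (hb : b.Holds s) (h : Runs c₁ s T s') : Runs (.ite b c₁ c₂) s (T + 1) s' := by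
  obtain ⟨t, ht, h⟩ := h
  exact ⟨t + 1, by omega, .ite_true hb h⟩

lemma ite_false (hb : ¬ b.Holds s) (h : Runs c₂ s T s') : Runs (.ite b c₁ c₂) s (T + 1) s' := by
  obtain ⟨t, ht, h⟩ := h
  exact ⟨t + 1, by omega, .ite_false hb h⟩

lemma loop_done (hb : ¬ b.Holds s) : Runs (.loop b c) s 1 s := ⟨1, le_rfl, .loop_done hb⟩

lemma loop_next (hb : b.Holds s) (h : Runs c s T s') (h' : Runs (.loop b c) s' T' s'') :
    Runs (.loop b c) s (T + T' + 1) s'' := by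
  obtain ⟨t, ht, h⟩ := h
  obtain ⟨t', ht', h'⟩ := h'
  exact ⟨t + t' + 1, by omega, .loop_next hb h h'⟩

lemma mono (h : Runs c s T s') (hT : T ≤ T') : Runs c s T' s' := by
  obtain ⟨t, ht, h⟩ := h
  exact ⟨t, ht.trans hT, h⟩

lemma block (l : List Instr) (s : Store) : Runs (block l) s l.length (l.foldl Store.exec s) := by
  induction l generalizing s with
  | nil => exact skip s
  | cons a l ih =>
    rw [List.length_cons, Nat.add_comm]
    exact seq ⟨1, le_rfl, .instr a s⟩ (ih _)

end Runs

/-! ### A tournament tree -/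

/-- Node `w` of the implicit binary tree, with children `2 * w` and `2 * w + 1`, is correct: its
best key `bk w` is the largest of its own key and of the best keys of its children, and its best
label `bc w` belongs to that key. -/
def NodeOK (key : ℕ → ℝ) (lab : ℕ → ℕ) (bk : ℕ → ℝ) (bc : ℕ → ℕ) (w : ℕ) : Prop :=
  key w ≤ bk w ∧ bk (2 * w) ≤ bk w ∧ bk (2 * w + 1) ≤ bk w ∧
    ((bk w = key w ∧ bc w = lab w) ∨ (bk w = bk (2 * w) ∧ bc w = bc (2 * w)) ∨
      (bk w = bk (2 * w + 1) ∧ bc w = bc (2 * w + 1)))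

/-- Node `w` lies on the path from node `v` to the root, or above the root (then it is `0`). -/
def IsAncestor (w v : ℕ) : Prop := ∃ k, v / 2 ^ k = w

lemma IsAncestor.refl (v : ℕ) : IsAncestor v v := ⟨0, by simp⟩

lemma IsAncestor.eq_or_half {w v : ℕ} (h : IsAncestor w v) : w = v ∨ IsAncestor w (v / 2) := by
  obtain ⟨k, hk⟩ := h
  cases k with
  | zero => left; simpa using hk.symm
  | succ k => right; exact ⟨k, by rw [← hk, Nat.div_div_eq_div_mul, pow_succ, mul_comm]⟩

lemma isAncestor_zero {w : ℕ} : IsAncestor w 0 ↔ w = 0 :=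
  ⟨fun ⟨k, hk⟩ => by simpa using hk.symm, fun h => h ▸ IsAncestor.refl 0⟩

section Tree

variable {key : ℕ → ℝ} {lab : ℕ → ℕ} {bk : ℕ → ℝ} {bc : ℕ → ℕ}

lemma key_le_root (h : ∀ w, 1 ≤ w → NodeOK key lab bk bc w) {w : ℕ} (hw : 1 ≤ w) :
    key w ≤ bk 1 := by
  have hbk : ∀ w, 1 ≤ w → bk w ≤ bk 1 := by
    intro w
    induction w using Nat.strong_induction_on with
    | _ w ih =>
      intro hw
      rcases hw.eq_or_lt with rfl | hw
      · exact le_rfl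
      · have h1 := h (w / 2) (by omega)
        refine le_trans ?_ (ih (w / 2) (by omega) (by omega))
        rcases Nat.mod_two_eq_zero_or_one w with h2 | h2
        · have h3 := h1.2.1
          rwa [show 2 * (w / 2) = w by omega] at h3
        · have h3 := h1.2.2.1
          rwa [show 2 * (w / 2) + 1 = w by omega] at h3
  exact (h w hw).1.trans (hbk w hw)

lemma bestKey_attained (h : ∀ w, 1 ≤ w → NodeOK key lab bk bc w) {n : ℕ}
    (hout : ∀ w, n < w → bk w = 0) {w : ℕ} (hw : 1 ≤ w) :
    bk w = 0 ∨ ∃ v, 1 ≤ v ∧ v ≤ n ∧ bk w = key v ∧ bc w = lab v := by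
  induction hk : n + 1 - w using Nat.strong_induction_on generalizing w with
  | _ k ih =>
    subst hk
    rcases lt_or_ge n w with hn | hn
    · exact Or.inl (hout w hn)
    · rcases (h w hw).2.2.2 with ⟨h1, h2⟩ | ⟨h1, h2⟩ | ⟨h1, h2⟩
      · exact Or.inr ⟨w, hw, hn, h1, h2⟩
      · rw [h1, h2]
        exact ih (n + 1 - 2 * w) (by omega) (by omega) rfl
      · rw [h1, h2]
        exact ih (n + 1 - (2 * w + 1)) (by omega) (by omega) rfl

lemma NodeOK.congr {key' : ℕ → ℝ} {lab' : ℕ → ℕ} {bk' : ℕ → ℝ} {bc' : ℕ → ℕ} {w : ℕ}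
    (h : NodeOK key lab bk bc w) (h1 : key' w = key w) (h2 : lab' w = lab w)
    (h3 : ∀ v, v = w ∨ v = 2 * w ∨ v = 2 * w + 1 → bk' v = bk v ∧ bc' v = bc v) :
    NodeOK key' lab' bk' bc' w := by
  have e1 := h3 w (Or.inl rfl)
  have e2 := h3 (2 * w) (Or.inr (Or.inl rfl))
  have e3 := h3 (2 * w + 1) (Or.inr (Or.inr rfl))
  unfold NodeOK at h ⊢
  rw [h1, h2, e1.1, e1.2, e2.1, e2.2, e3.1, e3.2]
  exact h

end Tree

/-! ### The online algorithm -/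

/-- Replace the candidate (key in real register `10`, coin in register `3`) by the best one of the
node in register `8`, if that has a larger key. -/
def challengeCmd : Cmd :=
  .seq (block [.rload 11 1 8])
    (.ite (.rle 11 10) .skip (block [.rmul 10 11 6, .nload 3 2 8]))

/-- Recompute the node in register `7` from its own coin and its children, and move on to its
parent. -/
def repairCmd : Cmd :=
  .seq (block [.rload 10 0 7, .nload 3 1 7, .nadd 8 7 7])
    (.seq challengeCmd (.seq (block [.nadd 8 8 6]) (.seq challengeCmd
      (block [.rstore 1 7 10, .nstore 2 7 3, .nhalf 7 7]))))

/-- Recompute the path from the node in register `7` to the root. -/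
def climbCmd : Cmd := .loop (.nle 6 7) repairCmd

/-- Put the node of the coin in register `0` into register `7`; a coin that is tossed for the first
time gets the next free node, with the key `α`. Keep register `5` above all tossed coins. -/
def lookupCmd : Cmd :=
  .seq (block [.nload 7 0 0])
    (.seq (.ite (.nle 6 7) .skip
      (block [.nadd 4 4 6, .nadd 7 4 9, .nstore 0 0 7, .nstore 1 7 0, .rstore 0 7 2]))
    (.seq (block [.nadd 8 0 6]) (.ite (.nle 5 8) (block [.nadd 5 8 9]) .skip)))

/-- Update the key of the node in register `7` by Bayes' rule, for the outcome in register `1`. -/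
def bayesCmd : Cmd :=
  .seq (block [.rload 10 0 7, .rsub 11 6 10])
    (.seq (.ite (.nle 6 1) (block [.rmul 10 10 4, .rmul 11 11 5])
      (block [.rmul 10 10 7, .rmul 11 11 8]))
    (block [.radd 11 10 11, .rdiv 10 10 11, .rstore 0 7 10]))

/-- Find the answer: the coin at the root competes with a fresh coin, and the winner is output if
its key is at least `1 - δ`. -/
def answerCmd : Cmd :=
  .seq (block [.rload 10 1 6, .nload 3 2 6])
    (.seq (.ite (.rle 2 10) .skip (block [.rmul 10 2 6, .nadd 3 5 9]))
    (.ite (.rle 9 10) (block [.nconst 2 1]) (block [.nconst 2 0])))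

/-- Likelihood-Toss with a tournament tree. Array `0` of natural numbers maps a coin to its node
(`0` if it is fresh), array `1` maps a node to its coin and array `2` to the best coin of its
subtree; the real arrays `0` and `1` hold the conditional probabilities to be heavy of these two
coins. Register `4` counts the nodes. -/
def likelihoodTossAlgorithm : OnlineAlgorithm where
  start := .seq (block [.rconst 6 1, .radd 4 0 1, .rsub 5 0 1, .rsub 7 6 4, .rsub 8 6 5,
    .rsub 9 6 3, .nconst 6 1]) answerCmd
  next := .seq lookupCmd (.seq bayesCmd (.seq climbCmd answerCmd))

lemma runs_challenge (s : Store) (h6 : s.rreg 6 = 1) :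
    ∃ s', Runs challengeCmd s 4 s' ∧ s'.nmem = s.nmem ∧ s'.rmem = s.rmem ∧
      (∀ r, r ≠ 3 → s'.nreg r = s.nreg r) ∧
      (∀ r, r ≠ 10 → r ≠ 11 → s'.rreg r = s.rreg r) ∧
      s.rreg 10 ≤ s'.rreg 10 ∧ s.rmem 1 (s.nreg 8) ≤ s'.rreg 10 ∧
      ((s'.rreg 10 = s.rreg 10 ∧ s'.nreg 3 = s.nreg 3) ∨
        (s'.rreg 10 = s.rmem 1 (s.nreg 8) ∧ s'.nreg 3 = s.nmem 2 (s.nreg 8))) := by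
  have hb := Runs.block [.rload 11 1 8] s
  by_cases h : s.rmem 1 (s.nreg 8) ≤ s.rreg 10
  · refine ⟨_, (hb.seq (.ite_true ?_ (.skip _))).mono (by simp), ?_⟩
    · simpa [Test.Holds, Store.exec, Store.setR] using h
    · simp +contextual [Store.exec, Store.setR, h]
  · refine ⟨_, (hb.seq (.ite_false ?_ (.block _ _))).mono (by simp), ?_⟩
    · simpa [Test.Holds, Store.exec, Store.setR] using h
    · simp +contextual [Store.exec, Store.setR, Store.setN, h6, (not_le.1 h).le]

lemma runs_repair (s : Store) (h6 : s.rreg 6 = 1) (hn6 : s.nreg 6 = 1) {u : ℕ}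
    (hu : s.nreg 7 = u) :
    ∃ s' x y, Runs repairCmd s 15 s' ∧ s'.nreg 7 = u / 2 ∧
      s'.nmem = Function.update s.nmem 2 (Function.update (s.nmem 2) u y) ∧
      s'.rmem = Function.update s.rmem 1 (Function.update (s.rmem 1) u x) ∧
      (∀ r, r ≠ 3 → r ≠ 7 → r ≠ 8 → s'.nreg r = s.nreg r) ∧
      (∀ r, r ≠ 10 → r ≠ 11 → s'.rreg r = s.rreg r) ∧
      s.rmem 0 u ≤ x ∧ s.rmem 1 (2 * u) ≤ x ∧ s.rmem 1 (2 * u + 1) ≤ x ∧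
      ((x = s.rmem 0 u ∧ y = s.nmem 1 u) ∨ (x = s.rmem 1 (2 * u) ∧ y = s.nmem 2 (2 * u)) ∨
        (x = s.rmem 1 (2 * u + 1) ∧ y = s.nmem 2 (2 * u + 1))) := by
  have hb1 := Runs.block [.rload 10 0 7, .nload 3 1 7, .nadd 8 7 7] s
  set s1 := List.foldl Store.exec s [.rload 10 0 7, .nload 3 1 7, .nadd 8 7 7] with hs1
  obtain ⟨s2, hb2, nm2, rm2, nr2, rr2, le2, le2', or2⟩ := runs_challenge s1 (by
    simpa [hs1, Store.exec, Store.setR, Store.setN] using h6)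
  have hb3 := Runs.block [.nadd 8 8 6] s2
  set s3 := List.foldl Store.exec s2 [.nadd 8 8 6] with hs3
  obtain ⟨s4, hb4, nm4, rm4, nr4, rr4, le4, le4', or4⟩ := runs_challenge s3 (by
    have : s2.rreg 6 = s1.rreg 6 := rr2 6 (by norm_num) (by norm_num)
    simpa [hs3, this, hs1, Store.exec, Store.setR, Store.setN] using h6)
  have hb5 := Runs.block [.rstore 1 7 10, .nstore 2 7 3, .nhalf 7 7] s4
  have e1 : s1.nmem = s.nmem ∧ s1.rmem = s.rmem ∧ s1.nreg 8 = 2 * u ∧ s1.rreg 10 = s.rmem 0 u ∧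
      s1.nreg 3 = s.nmem 1 u ∧ (∀ r, r ≠ 3 → r ≠ 8 → s1.nreg r = s.nreg r) ∧
      (∀ r, r ≠ 10 → s1.rreg r = s.rreg r) := by
    simp +contextual [hs1, Store.exec, Store.setR, Store.setN, hu, two_mul]
  have e3 : s3.nmem = s2.nmem ∧ s3.rmem = s2.rmem ∧ s3.nreg 8 = s2.nreg 8 + s2.nreg 6 ∧
      s3.rreg = s2.rreg ∧ s3.nreg 3 = s2.nreg 3 ∧ (∀ r, r ≠ 8 → s3.nreg r = s2.nreg r) := by
    simp +contextual [hs3, Store.exec, Store.setN]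
  obtain ⟨a1, a2, a3, a4, a5, a6, a7⟩ := e1
  obtain ⟨b1, b2, b3, b4, b5, b6⟩ := e3
  have e8 : s3.nreg 8 = 2 * u + 1 := by
    rw [b3, nr2 8 (by norm_num), nr2 6 (by norm_num), a3, a6 6 (by norm_num) (by norm_num), hn6]
  have e7 : s4.nreg 7 = u := by
    rw [nr4 7 (by norm_num), b6 7 (by norm_num), nr2 7 (by norm_num),
      a6 7 (by norm_num) (by norm_num), hu]
  rw [e8, b1, b2, nm2, rm2, a1, a2, b4, b5] at or4
  rw [e8, b2, rm2, a2] at le4'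
  rw [b4] at le4
  rw [a1, a2, a3, a4, a5] at or2
  rw [a2, a3] at le2'
  rw [a4] at le2
  refine ⟨_, s4.rreg 10, s4.nreg 3, (hb1.seq (hb2.seq (hb3.seq (hb4.seq hb5)))).mono (by simp), ?_,
    ?_, ?_, ?_, ?_, le2.trans le4, le2'.trans le4, le4', ?_⟩
  · simp [Store.exec, Store.setN, e7]
  · simp [Store.exec, Store.setN, e7, nm4, b1, nm2, a1]
  · simp [Store.exec, Store.setN, e7, rm4, b2, rm2, a2]
  · intro r h3 h7 h8
    simp [Store.exec, Store.setN, h7, nr4 r h3, b6 r h8, nr2 r h3, a6 r h3 h8]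
  · intro r h10 h11
    simp [Store.exec, Store.setN, rr4 r h10 h11, b4, rr2 r h10 h11, a7 r h10]
  · rcases or4 with ⟨h1, h2⟩ | h
    · rw [h1, h2]
      rcases or2 with h | h
      · exact Or.inl h
      · exact Or.inr (Or.inl h)
    · exact Or.inr (Or.inr h)

/-- The memory of the algorithm when the coins in `S` have nodes and the states of the coins are
`x`. The nodes on the path from node `v` to the root may be out of date. -/
structure Represents (θ : Setting) (S : Finset ℕ) (x : ℕ → ℕ × ℕ) (v : ℕ) (s : Store) : Prop where
  alpha : s.rreg 2 = θ.α
  heads_heavy : s.rreg 4 = θ.p + θ.ε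
  heads_light : s.rreg 5 = θ.p - θ.ε
  real_one : s.rreg 6 = 1
  tails_heavy : s.rreg 7 = 1 - (θ.p + θ.ε)
  tails_light : s.rreg 8 = 1 - (θ.p - θ.ε)
  target : s.rreg 9 = 1 - θ.δ
  card : s.nreg 4 = S.card
  bound : ∀ i ∈ S, i < s.nreg 5
  nat_one : s.nreg 6 = 1
  nat_zero : s.nreg 9 = 0
  one_le_node : ∀ i, 1 ≤ s.nmem 0 i ↔ i ∈ S
  node_le : ∀ i, s.nmem 0 i ≤ S.card
  coin_node : ∀ i ∈ S, s.nmem 1 (s.nmem 0 i) = i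
  node_coin : ∀ w, 1 ≤ w → w ≤ S.card → s.nmem 1 w ∈ S ∧ s.nmem 0 (s.nmem 1 w) = w
  key_eq : ∀ w, 1 ≤ w → w ≤ S.card → s.rmem 0 w = θ.post (x (s.nmem 1 w))
  bestKey_of_lt : ∀ w, S.card < w → s.rmem 1 w = 0
  nodeOK : ∀ w, ¬ IsAncestor w v → NodeOK (s.rmem 0) (s.nmem 1) (s.rmem 1) (s.nmem 2) w

namespace Represents

variable {θ : Setting} {S : Finset ℕ} {x : ℕ → ℕ × ℕ} {v : ℕ} {s : Store}

/-- Only some of the registers matter. -/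
lemma congr (h : Represents θ S x v s) {s' : Store} (hnm : s'.nmem = s.nmem)
    (hrm : s'.rmem = s.rmem) (hn : ∀ r, r = 4 ∨ r = 5 ∨ r = 6 ∨ r = 9 → s'.nreg r = s.nreg r)
    (hr : ∀ r, r < 10 → s'.rreg r = s.rreg r) : Represents θ S x v s' := by
  constructor
  · rw [hr _ (by norm_num)]; exact h.alpha
  · rw [hr _ (by norm_num)]; exact h.heads_heavy
  · rw [hr _ (by norm_num)]; exact h.heads_light
  · rw [hr _ (by norm_num)]; exact h.real_one
  · rw [hr _ (by norm_num)]; exact h.tails_heavy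
  · rw [hr _ (by norm_num)]; exact h.tails_light
  · rw [hr _ (by norm_num)]; exact h.target
  · rw [hn _ (by norm_num)]; exact h.card
  · rw [hn _ (by norm_num)]; exact h.bound
  · rw [hn _ (by norm_num)]; exact h.nat_one
  · rw [hn _ (by norm_num)]; exact h.nat_zero
  · rw [hnm]; exact h.one_le_node
  · rw [hnm]; exact h.node_le
  · rw [hnm]; exact h.coin_node
  · rw [hnm]; exact h.node_coin
  · rw [hnm, hrm]; exact h.key_eq
  · rw [hrm]; exact h.bestKey_of_lt
  · rw [hnm, hrm]; exact h.nodeOK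

/-- Climbing repairs the path to the root, in time proportional to its length. -/
lemma runs_climb (k : ℕ) (h : Represents θ S x v s) (hv : s.nreg 7 = v) (hvS : v ≤ S.card)
    (hk : v < 2 ^ k) :
    ∃ s', Runs climbCmd s (16 * k + 1) s' ∧ Represents θ S x 0 s' := by
  induction k generalizing s v with
  | zero =>
    obtain rfl : v = 0 := by simpa using hk
    exact ⟨s, Runs.loop_done (by simp [Test.Holds, hv, h.nat_one]), h⟩
  | succ k ih =>
    rcases Nat.eq_zero_or_pos v with rfl | hpos
    · exact ⟨s, (Runs.loop_done (by simp [Test.Holds, hv, h.nat_one])).mono (by omega), h⟩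
    · obtain ⟨s1, a, b, hrun, h7, hnm, hrm, hn, hr, le1, le2, le3, hor⟩ :=
        runs_repair s h.real_one h.nat_one hv
      have n0 : s1.nmem 0 = s.nmem 0 := by simp [hnm]
      have n1 : s1.nmem 1 = s.nmem 1 := by simp [hnm]
      have n2 : s1.nmem 2 = Function.update (s.nmem 2) v b := by simp [hnm]
      have r0 : s1.rmem 0 = s.rmem 0 := by simp [hrm]
      have r1 : s1.rmem 1 = Function.update (s.rmem 1) v a := by simp [hrm]
      have h1 : Represents θ S x (v / 2) s1 := by
        constructor
        · rw [hr _ (by norm_num) (by norm_num)]; exact h.alpha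
        · rw [hr _ (by norm_num) (by norm_num)]; exact h.heads_heavy
        · rw [hr _ (by norm_num) (by norm_num)]; exact h.heads_light
        · rw [hr _ (by norm_num) (by norm_num)]; exact h.real_one
        · rw [hr _ (by norm_num) (by norm_num)]; exact h.tails_heavy
        · rw [hr _ (by norm_num) (by norm_num)]; exact h.tails_light
        · rw [hr _ (by norm_num) (by norm_num)]; exact h.target
        · rw [hn _ (by norm_num) (by norm_num) (by norm_num)]; exact h.card
        · rw [hn _ (by norm_num) (by norm_num) (by norm_num)]; exact h.bound
        · rw [hn _ (by norm_num) (by norm_num) (by norm_num)]; exact h.nat_one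
        · rw [hn _ (by norm_num) (by norm_num) (by norm_num)]; exact h.nat_zero
        · rw [n0]; exact h.one_le_node
        · rw [n0]; exact h.node_le
        · rw [n0, n1]; exact h.coin_node
        · rw [n0, n1]; exact h.node_coin
        · rw [n1, r0]; exact h.key_eq
        · intro w hw
          rw [r1, Function.update_of_ne (by omega)]
          exact h.bestKey_of_lt w hw
        · intro w hw
          rw [r0, n1, r1, n2]
          by_cases hwv : w = v
          · subst hwv
            unfold NodeOK
            simp only [Function.update_self, Function.update_of_ne (show 2 * w ≠ w by omega),
              Function.update_of_ne (show 2 * w + 1 ≠ w by omega)]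
            exact ⟨le1, le2, le3, hor⟩
          · have hw' : ¬ IsAncestor w v := fun hc =>
              hc.eq_or_half.elim hwv hw
            refine (h.nodeOK w hw').congr rfl rfl fun c hc => ?_
            -- a child of `w` is not `v`, for otherwise `w = v / 2`
            have hcv : c ≠ v := by
              rintro rfl
              rcases hc with hc | hc | hc
              · exact hwv hc.symm
              · exact hw ⟨0, by simp; omega⟩
              · exact hw ⟨0, by simp; omega⟩
            rw [Function.update_of_ne hcv, Function.update_of_ne hcv]
            exact ⟨rfl, rfl⟩
      obtain ⟨s2, hrun2, h2⟩ := ih h1 h7 (by omega) (by omega)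
      refine ⟨s2, (Runs.loop_next ?_ hrun hrun2).mono (by omega), h2⟩
      simp only [Test.Holds, h.nat_one, hv]
      omega

lemma runs_lookup (h : Represents θ S x 0 s) {i : ℕ} (hi : s.nreg 0 = i)
    (hx : i ∉ S → x i = (0, 0)) :
    ∃ s' v, Runs lookupCmd s 10 s' ∧ Represents θ (insert i S) x v s' ∧ s'.nreg 7 = v ∧
      s'.nmem 0 i = v ∧ s'.nreg 1 = s.nreg 1 := by
  -- the last part of the program, which only changes the bound on the coins
  have hlast : ∀ s1 : Store, s1.nreg 6 = 1 → s1.nreg 9 = 0 → s1.nreg 0 = i →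
      ∃ s', Runs (.seq (block [.nadd 8 0 6]) (.ite (.nle 5 8) (block [.nadd 5 8 9]) .skip))
          s1 3 s' ∧
        s'.nmem = s1.nmem ∧ s'.rmem = s1.rmem ∧ s'.rreg = s1.rreg ∧
        (∀ r, r ≠ 5 → r ≠ 8 → s'.nreg r = s1.nreg r) ∧ s1.nreg 5 ≤ s'.nreg 5 ∧ i < s'.nreg 5 := by
    intro s1 h6 h9 h0
    have hb := Runs.block [.nadd 8 0 6] s1
    by_cases h5 : s1.nreg 5 ≤ i + 1
    · refine ⟨_, (hb.seq (.ite_true ?_ (.block _ _))).mono (by simp), ?_⟩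
      · simpa [Test.Holds, Store.exec, Store.setN, h6, h0] using h5
      · simp +contextual [Store.exec, Store.setN, h6, h0, h9, h5]
    · refine ⟨_, (hb.seq (.ite_false ?_ (.skip _))).mono (by simp), ?_⟩
      · simpa [Test.Holds, Store.exec, Store.setN, h6, h0] using h5
      · simp +contextual [Store.exec, Store.setN]
        omega
  have hb := Runs.block [.nload 7 0 0] s
  by_cases hiS : i ∈ S
  · have h1 := (h.one_le_node i).2 hiS
    obtain ⟨s', hrun, nm, rm, rr, nr, le5, lt5⟩ := hlast ([.nload 7 0 0].foldl Store.exec s)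
      (by simpa [Store.exec, Store.setN] using h.nat_one)
      (by simpa [Store.exec, Store.setN] using h.nat_zero)
      (by simpa [Store.exec, Store.setN] using hi)
    refine ⟨s', s.nmem 0 i, (hb.seq (Runs.seq (.ite_true ?_ (.skip _)) hrun)).mono (by simp),
      ?_, ?_, ?_, ?_⟩
    · simpa [Test.Holds, Store.exec, Store.setN, h.nat_one, hi] using h1
    · simp only [List.foldl, Store.exec, Store.setN] at nm rm rr nr le5
      rw [Finset.insert_eq_self.2 hiS]
      constructor
      · rw [rr]; exact h.alpha
      · rw [rr]; exact h.heads_heavy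
      · rw [rr]; exact h.heads_light
      · rw [rr]; exact h.real_one
      · rw [rr]; exact h.tails_heavy
      · rw [rr]; exact h.tails_light
      · rw [rr]; exact h.target
      · simpa [nr] using h.card
      · intro j hj
        exact (h.bound j hj).trans_le (by simpa using le5)
      · simpa [nr] using h.nat_one
      · simpa [nr] using h.nat_zero
      · rw [nm]; exact h.one_le_node
      · rw [nm]; exact h.node_le
      · rw [nm]; exact h.coin_node
      · rw [nm]; exact h.node_coin
      · rw [nm, rm]; exact h.key_eq
      · rw [rm]; exact h.bestKey_of_lt
      · rw [nm, rm]
        intro w hw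
        refine h.nodeOK w fun hc => hw ?_
        rw [isAncestor_zero.1 hc]
        exact ⟨s.nmem 0 i, Nat.div_eq_of_lt Nat.lt_two_pow_self⟩
    · rw [nr 7 (by norm_num) (by norm_num)]
      simp [Store.exec, Store.setN, hi]
    · rw [nm]
      simp [Store.exec, Store.setN]
    · rw [nr 1 (by norm_num) (by norm_num)]
      simp [Store.exec, Store.setN]
  · have h1 : ¬ 1 ≤ s.nmem 0 i := fun hc => hiS ((h.one_le_node i).1 hc)
    set n := S.card with hn
    have hb2 := Runs.block [.nadd 4 4 6, .nadd 7 4 9, .nstore 0 0 7, .nstore 1 7 0, .rstore 0 7 2]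
      ([.nload 7 0 0].foldl Store.exec s)
    set s1 := [.nadd 4 4 6, .nadd 7 4 9, .nstore 0 0 7, .nstore 1 7 0, .rstore 0 7 2].foldl
      Store.exec ([.nload 7 0 0].foldl Store.exec s) with hs1
    have e : s1.nmem 0 = Function.update (s.nmem 0) i (n + 1) ∧
        s1.nmem 1 = Function.update (s.nmem 1) (n + 1) i ∧ s1.nmem 2 = s.nmem 2 ∧
        s1.rmem 0 = Function.update (s.rmem 0) (n + 1) θ.α ∧ s1.rmem 1 = s.rmem 1 ∧
        s1.rreg = s.rreg ∧ s1.nreg 4 = n + 1 ∧ s1.nreg 7 = n + 1 ∧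
        (∀ r, r ≠ 4 → r ≠ 7 → s1.nreg r = s.nreg r) := by
      simp +contextual [hs1, Store.exec, Store.setN, hi, h.nat_one, h.nat_zero, h.card, h.alpha, hn]
    obtain ⟨n0, n1, n2, r0, r1, rr, e4, e7, er⟩ := e
    obtain ⟨s', hrun, nm, rm, rr', nr, le5, lt5⟩ := hlast s1
      ((er 6 (by norm_num) (by norm_num)).trans h.nat_one)
      ((er 9 (by norm_num) (by norm_num)).trans h.nat_zero)
      ((er 0 (by norm_num) (by norm_num)).trans hi)
    have hcard : (insert i S).card = n + 1 := Finset.card_insert_of_notMem hiS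
    refine ⟨s', n + 1, (hb.seq (Runs.seq (.ite_false ?_ hb2) hrun)).mono (by simp),
      ?_, ?_, ?_, ?_⟩
    · simpa [Test.Holds, Store.exec, Store.setN, h.nat_one, hi] using h1
    · constructor
      · rw [rr', rr]; exact h.alpha
      · rw [rr', rr]; exact h.heads_heavy
      · rw [rr', rr]; exact h.heads_light
      · rw [rr', rr]; exact h.real_one
      · rw [rr', rr]; exact h.tails_heavy
      · rw [rr', rr]; exact h.tails_light
      · rw [rr', rr]; exact h.target
      · rw [nr 4 (by norm_num) (by norm_num), e4, hcard]
      · intro j hj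
        rcases Finset.mem_insert.1 hj with rfl | hj
        · exact lt5
        · refine (h.bound j hj).trans_le ?_
          rwa [er 5 (by norm_num) (by norm_num)] at le5
      · rw [nr 6 (by norm_num) (by norm_num), er 6 (by norm_num) (by norm_num)]; exact h.nat_one
      · rw [nr 9 (by norm_num) (by norm_num), er 9 (by norm_num) (by norm_num)]; exact h.nat_zero
      · intro j
        rw [nm, n0]
        by_cases hj : j = i
        · subst hj; simp
        · rw [Function.update_of_ne hj, Finset.mem_insert, h.one_le_node]
          simp [hj]
      · intro j
        rw [nm, n0, hcard]
        by_cases hj : j = i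
        · subst hj; simp
        · rw [Function.update_of_ne hj]
          exact (h.node_le j).trans (Nat.le_succ _)
      · intro j hj
        rw [nm, n0, n1]
        by_cases hji : j = i
        · subst hji; simp
        · have hjS : j ∈ S := (Finset.mem_insert.1 hj).resolve_left hji
          have := h.node_le j
          rw [Function.update_of_ne hji, Function.update_of_ne (by omega)]
          exact h.coin_node j hjS
      · intro w hw hw'
        rw [nm, n0, n1]
        by_cases hwn : w = n + 1
        · subst hwn; simp
        · obtain ⟨h2, h3⟩ := h.node_coin w hw (by omega)
          have hne : s.nmem 1 w ≠ i := fun hc => hiS (hc ▸ h2)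
          rw [Function.update_of_ne hwn, Function.update_of_ne hne]
          exact ⟨Finset.mem_insert_of_mem h2, h3⟩
      · intro w hw hw'
        rw [nm, rm, n1, r0]
        by_cases hwn : w = n + 1
        · subst hwn; simp [hx hiS, θ.post_zero]
        · rw [Function.update_of_ne hwn, Function.update_of_ne hwn]
          exact h.key_eq w hw (by omega)
      · intro w hw
        rw [rm, r1]
        exact h.bestKey_of_lt w (by omega)
      · intro w hw
        rw [nm, rm, r0, r1, n1, n2]
        have hwn : w ≠ n + 1 := fun hc => hw (hc ▸ IsAncestor.refl _)
        have hw0 : ¬ IsAncestor w 0 := fun hc => hw (by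
          rw [isAncestor_zero.1 hc]
          exact ⟨n + 1, Nat.div_eq_of_lt Nat.lt_two_pow_self⟩)
        exact (h.nodeOK w hw0).congr (Function.update_of_ne hwn _ _)
          (Function.update_of_ne hwn _ _) fun _ _ => ⟨rfl, rfl⟩
    · rw [nr 7 (by norm_num) (by norm_num), e7]
    · rw [nm, n0, Function.update_self]
    · rw [nr 1 (by norm_num) (by norm_num), er 1 (by norm_num) (by norm_num)]

lemma runs_bayes (h : Represents θ S x v s) {i : ℕ} (hi : i ∈ S) (hv : s.nreg 7 = v)
    (hnode : s.nmem 0 i = v) {b : Bool} (hb : s.nreg 1 = b.toNat) :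
    ∃ s', Runs bayesCmd s 8 s' ∧
      Represents θ S (Function.update x i (record (x i) b)) v s' ∧ s'.nreg 7 = v := by
  have hv1 : 1 ≤ v := hnode ▸ (h.one_le_node i).2 hi
  have hvS : v ≤ S.card := hnode ▸ h.node_le i
  have hlab : s.nmem 1 v = i := hnode ▸ h.coin_node i hi
  have hkey : s.rmem 0 v = θ.post (x i) := by rw [h.key_eq v hv1 hvS, hlab]
  have hex : ∃ s', Runs bayesCmd s 8 s' ∧ s'.nreg = s.nreg ∧ s'.nmem = s.nmem ∧
      s'.rmem 0 = Function.update (s.rmem 0) v (θ.post (record (x i) b)) ∧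
      s'.rmem 1 = s.rmem 1 ∧ ∀ r, r < 10 → s'.rreg r = s.rreg r := by
    have hb1 := Runs.block [.rload 10 0 7, .rsub 11 6 10] s
    cases b
    · refine ⟨_, (hb1.seq (Runs.seq (.ite_false ?_ (.block _ _)) (.block _ _))).mono (by simp), ?_⟩
      · simp [Test.Holds, Store.exec, Store.setR, h.nat_one, hb]
      · have hr : ∀ r < 10, r ≠ 10 ∧ r ≠ 11 := fun r hr => by omega
        simp +contextual [Store.exec, Store.setR, hv, hkey, h.real_one, h.tails_heavy,
          h.tails_light, θ.post_record_false, hr]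
    · refine ⟨_, (hb1.seq (Runs.seq (.ite_true ?_ (.block _ _)) (.block _ _))).mono (by simp), ?_⟩
      · simp [Test.Holds, Store.exec, Store.setR, h.nat_one, hb]
      · have hr : ∀ r < 10, r ≠ 10 ∧ r ≠ 11 := fun r hr => by omega
        simp +contextual [Store.exec, Store.setR, hv, hkey, h.real_one, h.heads_heavy,
          h.heads_light, θ.post_record_true, hr]
  obtain ⟨s', hrun, hn, hnm, r0, r1, hr⟩ := hex
  refine ⟨s', hrun, ?_, by rw [hn, hv]⟩
  constructor
  · rw [hr _ (by norm_num)]; exact h.alpha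
  · rw [hr _ (by norm_num)]; exact h.heads_heavy
  · rw [hr _ (by norm_num)]; exact h.heads_light
  · rw [hr _ (by norm_num)]; exact h.real_one
  · rw [hr _ (by norm_num)]; exact h.tails_heavy
  · rw [hr _ (by norm_num)]; exact h.tails_light
  · rw [hr _ (by norm_num)]; exact h.target
  · rw [hn]; exact h.card
  · rw [hn]; exact h.bound
  · rw [hn]; exact h.nat_one
  · rw [hn]; exact h.nat_zero
  · rw [hnm]; exact h.one_le_node
  · rw [hnm]; exact h.node_le
  · rw [hnm]; exact h.coin_node
  · rw [hnm]; exact h.node_coin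
  · intro w hw hw'
    rw [hnm, r0]
    by_cases hwv : w = v
    · subst hwv
      rw [Function.update_self, hlab, Function.update_self]
    · have hne : s.nmem 1 w ≠ i := fun hc => hwv (by
        rw [← (h.node_coin w hw hw').2, hc, hnode])
      rw [Function.update_of_ne hwv, Function.update_of_ne hne]
      exact h.key_eq w hw hw'
  · rw [r1]; exact h.bestKey_of_lt
  · intro w hw
    have hwv : w ≠ v := fun hc => hw (hc ▸ IsAncestor.refl _)
    rw [hnm, r0, r1]
    exact (h.nodeOK w hw).congr (Function.update_of_ne hwv _ _) rfl fun _ _ => ⟨rfl, rfl⟩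

lemma runs_answer (h : Represents θ S x 0 s) (hx : ∀ i, i ∉ S → x i = (0, 0)) :
    ∃ s' c, Runs answerCmd s 7 s' ∧ Represents θ S x 0 s' ∧
      (∀ j, θ.post (x j) ≤ θ.post (x c)) ∧
      s'.answer = if 1 - θ.δ ≤ θ.post (x c) then .output c else .toss c := by
  have hOK : ∀ w, 1 ≤ w → NodeOK (s.rmem 0) (s.nmem 1) (s.rmem 1) (s.nmem 2) w := fun w hw =>
    h.nodeOK w fun hc => by have := isAncestor_zero.1 hc; omega
  have hle : ∀ j ∈ S, θ.post (x j) ≤ s.rmem 1 1 := fun j hj => by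
    have h1 := key_le_root hOK ((h.one_le_node j).2 hj)
    rwa [h.key_eq _ ((h.one_le_node j).2 hj) (h.node_le j), h.coin_node j hj] at h1
  -- the candidate, after the comparison with a fresh coin
  have hcand : ∃ s1 c, Runs (.seq (block [.rload 10 1 6, .nload 3 2 6])
        (.ite (.rle 2 10) .skip (block [.rmul 10 2 6, .nadd 3 5 9]))) s 5 s1 ∧
      s1.nmem = s.nmem ∧ s1.rmem = s.rmem ∧ (∀ r, r ≠ 3 → s1.nreg r = s.nreg r) ∧
      (∀ r, r < 10 → s1.rreg r = s.rreg r) ∧ s1.nreg 3 = c ∧ s1.rreg 10 = θ.post (x c) ∧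
      ∀ j, θ.post (x j) ≤ θ.post (x c) := by
    have hb := Runs.block [.rload 10 1 6, .nload 3 2 6] s
    have hr : ∀ r < 10, r ≠ 10 := fun r hr => by omega
    by_cases hα : θ.α ≤ s.rmem 1 1
    · have hc : s.rmem 1 1 = θ.post (x (s.nmem 2 1)) := by
        rcases bestKey_attained hOK h.bestKey_of_lt le_rfl with h0 | ⟨u, hu1, hu2, hu3, hu4⟩
        · rw [h0] at hα
          exact absurd θ.α_pos (not_lt.2 hα)
        · rw [hu3, hu4, h.key_eq u hu1 hu2]
      refine ⟨_, s.nmem 2 1, (hb.seq (.ite_true ?_ (.skip _))).mono (by simp), ?_⟩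
      · simpa [Test.Holds, Store.exec, Store.setR, Store.setN, h.nat_one, h.alpha] using hα
      · have hmax : ∀ j, θ.post (x j) ≤ θ.post (x (s.nmem 2 1)) := fun j => by
          rw [← hc]
          by_cases hj : j ∈ S
          · exact hle j hj
          · rw [hx j hj, θ.post_zero]
            exact hα
        simp +contextual [Store.exec, Store.setR, Store.setN, h.nat_one, hc, hmax, hr]
    · have hfresh : x (s.nreg 5) = (0, 0) := hx _ fun hc => (h.bound _ hc).false
      refine ⟨_, s.nreg 5, (hb.seq (.ite_false ?_ (.block _ _))).mono (by simp), ?_⟩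
      · simpa [Test.Holds, Store.exec, Store.setR, Store.setN, h.nat_one, h.alpha] using hα
      · have hmax : ∀ j, θ.post (x j) ≤ θ.α := fun j => by
          by_cases hj : j ∈ S
          · exact (hle j hj).trans (not_le.1 hα).le
          · rw [hx j hj, θ.post_zero]
        simp +contextual [Store.exec, Store.setR, Store.setN, h.nat_zero, h.alpha, h.real_one,
          hfresh, θ.post_zero, hmax, hr]
  obtain ⟨s1, c, hrun, hnm, hrm, hn, hr, h3, h10, hmax⟩ := hcand
  have h1 : Represents θ S x 0 s1 := h.congr hnm hrm (fun r hr => hn r (by omega)) hr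
  have hfinal : ∃ s', Runs (.ite (.rle 9 10) (block [.nconst 2 1]) (block [.nconst 2 0])) s1 2 s' ∧
      s'.nmem = s1.nmem ∧ s'.rmem = s1.rmem ∧ (∀ r, r ≠ 2 → s'.nreg r = s1.nreg r) ∧
      s'.rreg = s1.rreg ∧
      s'.answer = if 1 - θ.δ ≤ θ.post (x c) then .output c else .toss c := by
    by_cases hδ : 1 - θ.δ ≤ θ.post (x c)
    · refine ⟨_, Runs.ite_true ?_ (.block _ _), ?_⟩
      · simpa [Test.Holds, h1.target, h10] using hδ
      · simp +contextual [Store.exec, Store.setN, Store.answer, h3, hδ]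
    · refine ⟨_, Runs.ite_false ?_ (.block _ _), ?_⟩
      · simpa [Test.Holds, h1.target, h10] using hδ
      · simp +contextual [Store.exec, Store.setN, Store.answer, h3, hδ]
  obtain ⟨s', hrun', hnm', hrm', hn', hr', hans⟩ := hfinal
  refine ⟨s', c, ?_, h1.congr hnm' hrm' (fun r hr => hn' r (by omega)) fun r _ => by rw [hr'],
    hmax, hans⟩
  obtain ⟨t, ht, he⟩ := hrun
  obtain ⟨t', ht', he'⟩ := hrun'
  cases he with
  | seq e1 e2 => exact ⟨_, by omega, .seq e1 (.seq e2 he')⟩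

end Represents

/-! ### Correctness and running time of the algorithm -/

lemma represents_start (θ : Setting) :
    ∃ s c, Runs likelihoodTossAlgorithm.start (Store.initial θ) 14 s ∧
      Represents θ ∅ (fun _ => (0, 0)) 0 s ∧
      s.answer = if 1 - θ.δ ≤ θ.post (0, 0) then .output c else .toss c := by
  have hb := Runs.block [.rconst 6 1, .radd 4 0 1, .rsub 5 0 1, .rsub 7 6 4, .rsub 8 6 5,
    .rsub 9 6 3, .nconst 6 1] (Store.initial θ)
  set s1 := [.rconst 6 1, .radd 4 0 1, .rsub 5 0 1, .rsub 7 6 4, .rsub 8 6 5,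
    .rsub 9 6 3, .nconst 6 1].foldl Store.exec (Store.initial θ) with hs1
  have h1 : Represents θ ∅ (fun _ => (0, 0)) 0 s1 := by
    constructor <;>
      simp [hs1, Store.exec, Store.setR, Store.setN, Store.initial, NodeOK]
    all_goals exact fun w hw hw' => by omega
  obtain ⟨s', c, hrun, h2, -, h4⟩ := h1.runs_answer fun _ _ => rfl
  exact ⟨s', c, (hb.seq hrun).mono (by simp), h2, h4⟩

/-- After every history the algorithm represents it, and its answer is a coin that is most likely
to be heavy. -/
lemma exists_reaches (θ : Setting) (h : History) :
    ∃ s t c, likelihoodTossAlgorithm.Reaches θ h s t ∧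
      t ≤ 42 + 16 * Nat.log 2 (History.coins h).card ∧
      Represents θ (History.coins h) (History.state h) 0 s ∧
      (∀ j, θ.post (History.state h j) ≤ θ.post (History.state h c)) ∧
      s.answer = if 1 - θ.δ ≤ θ.post (History.state h c) then .output c else .toss c := by
  induction h with
  | nil =>
    obtain ⟨s, c, ⟨t, ht, he⟩, h2, h4⟩ := represents_start θ
    exact ⟨s, t, c, .start he, by omega, h2, fun _ => le_rfl, h4⟩
  | cons a h ih =>
    obtain ⟨i, b⟩ := a
    obtain ⟨s, t, -, hreach, -, hs, -, -⟩ := ih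
    have h0 : Represents θ (History.coins h) (History.state h) 0 (s.receive i b) :=
      hs.congr rfl rfl (fun r hr => by
        rcases hr with rfl | rfl | rfl | rfl <;> simp [Store.receive, Store.setN]) fun _ _ => rfl
    obtain ⟨s1, v, hrun1, h1, h7, hnode, hr1⟩ := h0.runs_lookup (i := i)
      (by simp [Store.receive, Store.setN]) History.state_of_notMem
    obtain ⟨s2, hrun2, h2, h7'⟩ := h1.runs_bayes (Finset.mem_insert_self _ _) h7 hnode (b := b)
      (by rw [hr1]; simp [Store.receive, Store.setN])
    have hv : v ≤ (insert i (History.coins h)).card := hnode ▸ h1.node_le i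
    obtain ⟨s3, hrun3, h3⟩ := h2.runs_climb (Nat.log 2 (insert i (History.coins h)).card + 1) h7' hv
      (hv.trans_lt (Nat.lt_pow_succ_log_self one_lt_two _))
    rw [← History.coins_cons i b, ← History.state_cons] at h3
    obtain ⟨s4, c, hrun4, h4, hmax, hans⟩ := h3.runs_answer fun _ => History.state_of_notMem
    obtain ⟨t', ht', he⟩ := hrun1.seq (hrun2.seq (hrun3.seq hrun4))
    refine ⟨s4, t', c, .next hreach he, ?_, h4, hmax, hans⟩
    rw [History.coins_cons]
    omega

lemma time_le_log (n : ℕ) :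
    ((42 + 16 * Nat.log 2 n : ℕ) : ℝ) ≤ 116 * Real.log ((n : ℝ) + 2) := by
  have h2 : 1 / 2 < Real.log 2 := by linarith [Real.log_two_gt_d9]
  have h3 : Real.log 2 ≤ Real.log ((n : ℝ) + 2) :=
    Real.log_le_log (by norm_num) (by linarith [n.cast_nonneg (α := ℝ)])
  have h4 : (Nat.log 2 n : ℝ) * Real.log 2 ≤ Real.log ((n : ℝ) + 2) := by
    rw [← Real.log_pow]
    refine Real.log_le_log (by positivity) ?_
    rcases Nat.eq_zero_or_pos n with rfl | hn
    · simp
    · have : ((2 ^ Nat.log 2 n : ℕ) : ℝ) ≤ n := by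
        exact_mod_cast Nat.pow_log_le_self 2 hn.ne'
      push_cast at this
      linarith
  have h5 : (Nat.log 2 n : ℝ) * (1 / 2) ≤ (Nat.log 2 n : ℝ) * Real.log 2 :=
    mul_le_mul_of_nonneg_left h2.le (Nat.cast_nonneg _)
  push_cast
  linarith

lemma isLikelihoodToss_of_answer (θ : Setting) {σ : Strategy}
    (hσ : ∀ h, ∃ c, (∀ j, θ.post (History.state h j) ≤ θ.post (History.state h c)) ∧
      σ h = if 1 - θ.δ ≤ θ.post (History.state h c) then .output c else .toss c) :
    θ.IsLikelihoodToss σ := by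
  intro h
  obtain ⟨c, hmax, hans⟩ := hσ h
  have harg : θ.IsArgmax h c := fun j => (θ.likelihoodRatio_le_iff h h j c).2 (hmax j)
  refine ⟨fun hlt => ⟨c, harg, ?_⟩, fun ⟨i, hi⟩ => ⟨c, harg, ?_⟩⟩
  · rw [hans, if_neg fun hc => absurd ((θ.threshold_le_iff h c).2 hc) (not_le.2 (hlt c))]
  · rw [hans, if_pos ((θ.threshold_le_iff h c).1 (hi.trans (harg i)))]

end CoinLearning

end

theorem theorem1 :
    (∀ (θ : Setting) (σ : Strategy), θ.IsLikelihoodToss σ →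
      θ.IsOptimal σ ∧ ∀ h : History, 1 - θ.δ ≤ θ.successProb σ h) ∧
    (∃ (A : OnlineAlgorithm) (C : ℝ), ∀ θ : Setting,
      ∃ σ : Strategy, θ.IsLikelihoodToss σ ∧
        ∀ h : History, ∃ (s : Store) (t : ℕ), A.Reaches θ h s t ∧ s.answer = σ h ∧
          (t : ℝ) ≤ C * Real.log ((History.numCoins h : ℝ) + 2)) := by
  refine ⟨fun θ σ hσ => ⟨hσ.isOptimal, hσ.le_successProb⟩,
    likelihoodTossAlgorithm, 116, fun θ => ?_⟩
  choose s t c hreach ht _ hmax hans using exists_reaches θ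
  refine ⟨fun h => (s h).answer, isLikelihoodToss_of_answer θ fun h => ⟨c h, hmax h, hans h⟩,
    fun h => ⟨s h, t h, hreach h, rfl, ?_⟩⟩
  exact (Nat.cast_le.2 (ht h)).trans (time_le_log (History.coins h).card)
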